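/- All functions are measurable and finite almost everywhere on $\mathbb R^+=(0,\infty)$. For $1\le p\le\infty$ and a weight $w\ge 0$ on $\mathbb R^+$ let $\|f|L_{p,w}\|=\big(\int_0^\infty|w(x)f(x)|^p\,dx\big)^{1/p}$ for $f:\mathbb R^+\to\mathbb C$ (for $p=\infty$: $\operatorname{ess\,sup}_{x>0}|w(x)f(x)|$), and let $p'=p/(p-1)$ ($p'=1$ for $p=\infty$). Theorem 2.1. Let $n\in\mathbb N$, $1<p\le q\le\infty$, let $a_0,\dots,a_n:\mathbb R^+\to\mathbb C$, and let $u,v$ be non-negative functions on $\mathbb R^+$. Assume that there is a constant $D(u)$ such that $$\int_0^r u^{-p'}(x)\,dx<\infty\quad\text{for all } r>0,$$ $$\int_0^{2r}x^{(n-1)p'}u^{-p'}(x)\,dx\le D(u)\int_0^{r}x^{(n-1)p'}u^{-p'}(x)\,dx\quad\text{for all } r>0.$$ Then the following three assertions are equivalent: (i) there is $c<\infty$ such that for all $f\in L_{p,u}$ $$\Big\|\sum_{k=0}^n a_k(x)\int_0^x t^kf(t)\,dt\,\Big|\,L_{q,v}\Big\|\le c\,\|f|L_{p,u}\|;$$ (ii)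 for every $k=0,\dots,n$ there is $c_k<\infty$ such that for all $f\in L_{p,u}$ $$\Big\|a_k(x)\int_0^x t^kf(t)\,dt\,\Big|\,L_{q,v}\Big\|\le c_k\,\|f|L_{p,u}\|;$$ (iii) for every $k=0,\dots,n$ $$S_k=\sup_{r>0}\Big(\int_r^\infty|a_k(x)v(x)|^q\,dx\Big)^{1/q}\Big(\int_0^r x^{kp'}u^{-p'}(x)\,dx\Big)^{1/p'}<\infty$$ (for $q=\infty$ the first factor is $\operatorname{ess\,sup}_{x>r}|a_k(x)v(x)|$). Moreover, if $\widetilde c\in[0,\infty]$ is the best constant in (i) ($\widetilde c=\infty$ if (i) fails), then $$K_1\,\widetilde c\le\sum_{k=0}^nS_k\le K_2\,\widetilde c,$$ where $K_1>0$ depends only on $p,q$ and $0<K_2<\infty$ depends only on $D(u),n,p,q$. -/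

import Mathlib

open MeasureTheory Set
open scoped ENNReal NNReal

noncomputable section

namespace WeightedHardy

/-- Lebesgue measure on the half-line `(0, ∞)`. -/
def halfLine : Measure ℝ := volume.restrict (Ioi 0)

/-- The norm of `L_{p,w}(0, ∞)`: the `L_p(0, ∞)` norm of `w f` (the essential supremum of `|w f|`
for `p = ∞`), with values in `[0, ∞]`. -/
def weightedNorm (p : ℝ≥0∞) (w : ℝ → ℝ) (f : ℝ → ℂ) : ℝ≥0∞ :=
  eLpNorm (fun x => (w x : ℂ) * f x) p halfLine

/-- The conjugate exponent `p' = p / (p - 1)` of `p ∈ (1, ∞]`, as a real number (`p' = 1` for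
`p = ∞`). -/
def conjExp (p : ℝ≥0∞) : ℝ := (ENNReal.conjExponent p).toReal

/-- `∫_0^r x^s u(x)^{-p'} dx`, with values in `[0, ∞]` (`u(x)^{-p'} = ∞` where `u(x) = 0`). -/
def dualIntegral (p : ℝ≥0∞) (u : ℝ → ℝ) (s r : ℝ) : ℝ≥0∞ :=
  ∫⁻ x in Ioo 0 r, ENNReal.ofReal x ^ s * ENNReal.ofReal (u x) ^ (-conjExp p)

/-- `∫_0^x t^k f(t) dt`. When `∫_0^r u^{-p'} < ∞` for all `r`, the integrand is integrable for every
`f ∈ L_{p,u}`, by Hölder's inequality. -/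
def moment (k : ℕ) (f : ℝ → ℂ) (x : ℝ) : ℂ :=
  ∫ t in Ioo 0 x, (t : ℂ) ^ k * f t

/-- The operator `T` satisfies `‖T f | L_{q,v}‖ ≤ c ‖f | L_{p,u}‖` for all `f ∈ L_{p,u}`. -/
def BoundedWith (p q : ℝ≥0∞) (u v : ℝ → ℝ) (T : (ℝ → ℂ) → ℝ → ℂ) (c : ℝ≥0) : Prop :=
  ∀ f : ℝ → ℂ, AEStronglyMeasurable f halfLine → weightedNorm p u f < ∞ →
    weightedNorm q v (T f) ≤ c * weightedNorm p u f

/-- The best constant `c` in `‖T f | L_{q,v}‖ ≤ c ‖f | L_{p,u}‖`; it is `∞` if the inequality holds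
with no finite constant. -/
def bestConst (p q : ℝ≥0∞) (u v : ℝ → ℝ) (T : (ℝ → ℂ) → ℝ → ℂ) : ℝ≥0∞ :=
  ⨅ (c : ℝ≥0) (_ : BoundedWith p q u v T c), (c : ℝ≥0∞)

/-- `f ↦ a(x) ∫_0^x t^k f(t) dt`. -/
def summandOp (a : ℝ → ℂ) (k : ℕ) (f : ℝ → ℂ) (x : ℝ) : ℂ :=
  a x * moment k f x

/-- `f ↦ ∑_{k=0}^n a_k(x) ∫_0^x t^k f(t) dt`. -/
def sumOp {n : ℕ} (a : Fin (n + 1) → ℝ → ℂ) (f : ℝ → ℂ) (x : ℝ) : ℂ :=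
  ∑ k : Fin (n + 1), summandOp (a k) k f x

/-- `sup_{r > 0} ‖a v‖_{L_q(r, ∞)} (∫_0^r x^{k p'} u(x)^{-p'} dx)^{1/p'}`. -/
def hardyConst (p q : ℝ≥0∞) (u v : ℝ → ℝ) (a : ℝ → ℂ) (k : ℕ) : ℝ≥0∞ :=
  ⨆ (r : ℝ) (_ : 0 < r),
    eLpNorm (fun x => a x * (v x : ℂ)) q (volume.restrict (Ioi r)) *
      dualIntegral p u (k * conjExp p) r ^ (1 / conjExp p)

end WeightedHardy

end

namespace WeightedHardy

/-! Write e = p' and w = u^{-e}. Finite constants S_k give (ii) by Hardy's inequality for each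
summand (`weightedNorm_summandOp_le`), and (ii) gives (i) by Minkowski. The substance is that (i)
bounds every S_m, although the summands could cancel.

Cancellation is defeated by test functions supported in (0, r) all of whose moments of order at most
n vanish except the m-th: for x > r the sum is then a single summand. Let P minimise I = ∫_0^r |P|^e
w among polynomials of degree at most n whose m-th coefficient is 1, and put f = w φ(P) with φ(z) z
= |z|^e. The Euler–Lagrange equations of this minimum problem are the required orthogonality
relations, the m-th moment is I, and ‖f | L_{p,u}‖ ≤ I^{1/p}. Testing (i) gives ‖a_m v‖_{L_q(r,∞)}
I^{1/p'} ≤ c (`exists_testPoly`, `hardyConst_le_of_boundedWith`).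

It remains to bound ∫_0^r t^{me} w by a multiple of I, uniformly in r (`lintegral_coeff_le`).
Replace |P| by the majorant with factors t + |z| over the roots z. The two are comparable except
when t is within a fixed ratio of some |z|. The mass on these at most n dyadic intervals is moved to
the left by doubling. Order n - 1 suffices because near |z| the factor t + |z| stays comparable to a
constant, leaving at most n - 1 growing factors. -/

/-! ### Conjugate exponents, the dual weight and measurability of moments. -/

theorem one_le_conjExponent (p : ℝ≥0∞) : 1 ≤ ENNReal.conjExponent p := by
  simp [ENNReal.conjExponent]

theorem conjExponent_ne_top {p : ℝ≥0∞} (hp : 1 < p) : ENNReal.conjExponent p ≠ ∞ := by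
  simp [ENNReal.conjExponent, tsub_eq_zero_iff_le, hp]

theorem one_le_conjExp {p : ℝ≥0∞} (hp : 1 < p) : 1 ≤ conjExp p := by
  rw [conjExp, ← ENNReal.toReal_one]
  exact (ENNReal.toReal_le_toReal (by simp) (conjExponent_ne_top hp)).2 (one_le_conjExponent p)

theorem conjExp_pos {p : ℝ≥0∞} (hp : 1 < p) : 0 < conjExp p :=
  zero_lt_one.trans_le (one_le_conjExp hp)

theorem holderConjugate_conjExp {p : ℝ≥0∞} (hp : 1 < p) (hp' : p ≠ ∞) :
    p.toReal.HolderConjugate (conjExp p) := by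
  have := ENNReal.HolderConjugate.conjExponent hp.le
  exact ENNReal.HolderConjugate.toReal_of_ne_top hp' (conjExponent_ne_top hp)

theorem conjExp_top : conjExp ∞ = 1 := by
  simp [conjExp, ENNReal.conjExponent]

theorem aemeasurable_dualWeight {u : ℝ → ℝ} (hu : AEMeasurable u halfLine) (e : ℝ) :
    AEMeasurable (fun x => ENNReal.ofReal (u x) ^ (-e)) halfLine := by
  fun_prop

/-- The weight `u` is positive almost everywhere where its dual integral is finite. -/
theorem ae_pos_of_dualIntegral_lt_top {p : ℝ≥0∞} (hp : 1 < p) {u : ℝ → ℝ}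
    (hu : AEMeasurable u halfLine) (hd : ∀ r : ℝ, 0 < r → dualIntegral p u 0 r < ∞) :
    ∀ᵐ x ∂halfLine, 0 < u x := by
  have key : ∀ n : ℕ, ∀ᵐ x ∂(volume.restrict (Ioo (0 : ℝ) (n + 1))), 0 < u x := by
    intro n
    have h := hd (n + 1) (by positivity)
    simp only [dualIntegral, ENNReal.rpow_zero, one_mul] at h
    have hm : AEMeasurable (fun x => ENNReal.ofReal (u x) ^ (-conjExp p))
        (volume.restrict (Ioo (0 : ℝ) (n + 1))) :=
      (aemeasurable_dualWeight hu _).mono_measure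
        (Measure.restrict_mono Ioo_subset_Ioi_self le_rfl)
    filter_upwards [ae_lt_top' hm h.ne] with x hx
    by_contra hneg
    have h0 : ENNReal.ofReal (u x) = 0 := ENNReal.ofReal_eq_zero.2 (not_lt.1 hneg)
    rw [h0, ENNReal.zero_rpow_of_neg (by linarith [conjExp_pos hp])] at hx
    exact lt_irrefl _ hx
  have hU : Ioi (0 : ℝ) = ⋃ n : ℕ, Ioo (0 : ℝ) (n + 1) := by
    ext x
    simp only [mem_Ioi, mem_iUnion, mem_Ioo]
    refine ⟨fun hx => ?_, fun ⟨_, hx, _⟩ => hx⟩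
    obtain ⟨n, hn⟩ := exists_nat_gt x
    exact ⟨n, hx, by linarith⟩
  rw [halfLine, hU, ae_restrict_iUnion_iff]
  exact key

/-- Hölder's inequality for `t^k f` against the dual weight. -/
theorem lintegral_pow_mul_le {p : ℝ≥0∞} (hp : 1 < p) {u : ℝ → ℝ}
    (hu : AEMeasurable u halfLine) (hpos : ∀ᵐ x ∂halfLine, 0 < u x)
    {f : ℝ → ℂ} (hf : AEStronglyMeasurable f halfLine) (k : ℕ) {r : ℝ} {H : Set ℝ}
    (hH : H ⊆ Ioo 0 r) :
    ∫⁻ t in H, ‖(t : ℂ) ^ k * f t‖ₑ ≤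
      eLpNorm (fun x => (u x : ℂ) * f x) p (volume.restrict H) *
        dualIntegral p u (k * conjExp p) r ^ (1 / conjExp p) := by
  have hHI : H ⊆ Ioi 0 := hH.trans Ioo_subset_Ioi_self
  have hle : volume.restrict H ≤ halfLine := Measure.restrict_mono hHI le_rfl
  have hu' := hu.mono_measure hle
  have hf' := hf.mono_measure hle
  have hpos' := ae_mono hle hpos
  have he := conjExp_pos hp
  have := ENNReal.HolderConjugate.conjExponent hp.le
  -- Split t^k f as (t^k / u)(u f). The norm of u f is kept on H, so that the pieces over disjoint
  -- level sets can be summed later; the dual factor is enlarged to (0, r).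
  set φ : ℝ → ℝ := fun t => t ^ k * (u t)⁻¹ with hφ
  have hmφ : AEStronglyMeasurable φ (volume.restrict H) := by
    apply AEMeasurable.aestronglyMeasurable
    fun_prop
  have hmg : AEStronglyMeasurable (fun x => (u x : ℂ) * f x) (volume.restrict H) := by
    apply AEStronglyMeasurable.mul _ hf'
    exact (Complex.measurable_ofReal.comp_aemeasurable hu').aestronglyMeasurable
  have h1 : ∫⁻ t in H, ‖(t : ℂ) ^ k * f t‖ₑ =
      eLpNorm (φ • fun x => (u x : ℂ) * f x) 1 (volume.restrict H) := by
    rw [eLpNorm_one_eq_lintegral_enorm]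
    refine lintegral_congr_ae ?_
    filter_upwards [hpos'] with t ht
    congr 1
    have : (u t : ℂ) ≠ 0 := by exact_mod_cast ht.ne'
    simp only [hφ, Pi.smul_apply', Complex.real_smul]
    push_cast
    field_simp
  rw [h1]
  refine (eLpNorm_smul_le_mul_eLpNorm (p := ENNReal.conjExponent p) (q := p) hmg hmφ).trans ?_
  rw [mul_comm]
  gcongr
  rw [eLpNorm_eq_lintegral_rpow_enorm_toReal
    (zero_lt_one.trans_le (one_le_conjExponent p)).ne' (conjExponent_ne_top hp)]
  change (∫⁻ x in H, ‖φ x‖ₑ ^ conjExp p) ^ (1 / conjExp p) ≤ _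
  gcongr
  rw [dualIntegral]
  refine le_trans (le_of_eq ?_) (lintegral_mono_set hH)
  refine lintegral_congr_ae ?_
  filter_upwards [hpos', ae_mono hle (ae_restrict_mem measurableSet_Ioi)] with t ht ht0
  have ht0 : 0 < t := ht0
  have e1 : ‖φ t‖ₑ = ENNReal.ofReal t ^ k * (ENNReal.ofReal (u t))⁻¹ := by
    rw [Real.enorm_of_nonneg (by positivity), hφ]
    simp only
    rw [ENNReal.ofReal_mul (by positivity), ENNReal.ofReal_pow ht0.le, ENNReal.ofReal_inv_of_pos ht]
  rw [e1, ENNReal.mul_rpow_of_nonneg _ _ he.le, ENNReal.inv_rpow, ENNReal.rpow_neg,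
    ENNReal.rpow_natCast_mul]

theorem dualIntegral_lt_top {p : ℝ≥0∞} (hp : 1 < p) {u : ℝ → ℝ} (k : ℕ) {r : ℝ}
    (hd : dualIntegral p u 0 r < ∞) : dualIntegral p u (k * conjExp p) r < ∞ := by
  have he := conjExp_pos hp
  have hs : 0 ≤ k * conjExp p := by positivity
  refine lt_of_le_of_lt (b := ENNReal.ofReal r ^ (k * conjExp p) * dualIntegral p u 0 r) ?_
    (ENNReal.mul_lt_top (ENNReal.rpow_lt_top_of_nonneg hs (by simp)) hd)
  simp only [dualIntegral, ENNReal.rpow_zero, one_mul]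
  rw [← lintegral_const_mul' _ _ (ENNReal.rpow_lt_top_of_nonneg hs (by simp)).ne]
  refine setLIntegral_mono' measurableSet_Ioo fun x hx => ?_
  gcongr
  exact hx.2.le

theorem stronglyMeasurable_integral_Ioo {g : ℝ → ℂ} (hg : StronglyMeasurable g) :
    StronglyMeasurable fun x : ℝ => ∫ t in Ioo 0 x, g t := by
  have h : StronglyMeasurable
      (({z : ℝ × ℝ | 0 < z.2 ∧ z.2 < z.1}).indicator fun z => g z.2) := by
    refine (hg.comp_measurable measurable_snd).indicator ?_
    exact (measurableSet_lt measurable_const measurable_snd).inter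
      (measurableSet_lt measurable_snd measurable_fst)
  have h' := StronglyMeasurable.integral_prod_right' (ν := (volume : Measure ℝ)) h
  convert h' using 2 with x
  rw [← integral_indicator measurableSet_Ioo]
  rfl

theorem aestronglyMeasurable_moment {f : ℝ → ℂ} (hf : AEStronglyMeasurable f halfLine) (k : ℕ) :
    AEStronglyMeasurable (moment k f) halfLine := by
  have h : moment k f = fun x : ℝ => ∫ t in Ioo 0 x, (t : ℂ) ^ k * hf.mk f t := by
    funext x
    refine integral_congr_ae ?_
    have hle : volume.restrict (Ioo 0 x) ≤ halfLine :=
      Measure.restrict_mono Ioo_subset_Ioi_self le_rfl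
    filter_upwards [ae_mono hle hf.ae_eq_mk] with t ht
    rw [ht]
  rw [h]
  refine (stronglyMeasurable_integral_Ioo ?_).aestronglyMeasurable
  refine StronglyMeasurable.mul ?_ hf.stronglyMeasurable_mk
  exact (Complex.measurable_ofReal.pow_const k).stronglyMeasurable

/-! ### Hardy's inequality by dyadic level sets of the primitive. -/

/-- The first point at which the primitive of a non-negative function reaches a given level. -/
theorem exists_primitive_eq {g : ℝ → ℝ≥0∞} (hg : AEMeasurable g halfLine) {y : ℝ} (hy : 0 < y)
    (hfin : ∫⁻ t in Ioo 0 y, g t ≠ ∞) {c : ℝ≥0∞} (hc : 0 < c) (hcy : c < ∫⁻ t in Ioo 0 y, g t) :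
    ∃ x ∈ Ioo 0 y, ∫⁻ t in Ioo 0 x, g t = c ∧ ∀ s ∈ Ioo 0 x, ∫⁻ t in Ioo 0 s, g t < c := by
  have hgy : AEMeasurable g (volume.restrict (Ioo 0 y)) :=
    hg.mono_measure (Measure.restrict_mono Ioo_subset_Ioi_self le_rfl)
  have hint : IntegrableOn (fun t => (g t).toReal) (Icc 0 y) := by
    rw [integrableOn_Icc_iff_integrableOn_Ioo]
    exact integrable_toReal_of_lintegral_ne_top hgy hfin
  have hmono : Monotone fun x : ℝ => ∫⁻ t in Ioo 0 x, g t := fun a b hab =>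
    lintegral_mono_set (Ioo_subset_Ioo_right hab)
  set Φ : ℝ → ℝ := fun x => ∫ t in Ioc 0 x, (g t).toReal with hΦ
  have hcont : ContinuousOn Φ (Icc 0 y) := intervalIntegral.continuousOn_primitive hint
  have hΦF : ∀ x ∈ Icc 0 y, Φ x = (∫⁻ t in Ioo 0 x, g t).toReal := by
    intro x hx
    have hle : volume.restrict (Ioo 0 x) ≤ volume.restrict (Ioo 0 y) :=
      Measure.restrict_mono (Ioo_subset_Ioo_right hx.2) le_rfl
    rw [hΦ]
    simp only
    rw [Measure.restrict_congr_set Ioo_ae_eq_Ioc.symm]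
    refine integral_toReal (hgy.mono_measure hle) ?_
    exact ae_mono hle (ae_lt_top' hgy hfin)
  have hct : c ≠ ∞ := (hcy.trans_le le_top).ne
  have hS : (Icc 0 y ∩ Φ ⁻¹' {c.toReal}).Nonempty := by
    have h0 : Φ 0 < c.toReal := by
      simp only [hΦ, Ioc_self, Measure.restrict_empty, integral_zero_measure]
      exact ENNReal.toReal_pos hc.ne' hct
    have h1 : c.toReal < Φ y := by
      rw [hΦF y ⟨hy.le, le_rfl⟩]
      exact (ENNReal.toReal_lt_toReal hct hfin).2 hcy
    obtain ⟨x, hx, hxc⟩ := intermediate_value_Ioo hy.le hcont ⟨h0, h1⟩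
    exact ⟨x, Ioo_subset_Icc_self hx, hxc⟩
  have hcomp : IsCompact (Icc 0 y ∩ Φ ⁻¹' {c.toReal}) :=
    isCompact_Icc.of_isClosed_subset
      (hcont.preimage_isClosed_of_isClosed isClosed_Icc isClosed_singleton) inter_subset_left
  -- The primitive may be constant on an interval; the least solution is the one before which it
  -- stays strictly below c.
  obtain ⟨x, ⟨hxI, hxc⟩, hmin⟩ := hcomp.exists_isLeast hS
  have hFx : ∀ s ∈ Icc 0 y, ∫⁻ t in Ioo 0 s, g t ≠ ∞ := fun s hs =>
    ((hmono hs.2).trans_lt hfin.lt_top).ne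
  have hxc' : ∫⁻ t in Ioo 0 x, g t = c := by
    have h : Φ x = c.toReal := hxc
    rw [hΦF x hxI] at h
    exact (ENNReal.toReal_eq_toReal_iff' (hFx x hxI) hct).1 h
  refine ⟨x, ⟨?_, ?_⟩, hxc', fun s hs => ?_⟩
  · refine hxI.1.lt_of_ne fun h => hc.ne ?_
    rw [← hxc', ← h]
    simp
  · refine hxI.2.lt_of_ne fun h => hcy.ne ?_
    rw [← hxc', h]
  · refine ((hmono hs.2.le).trans_eq hxc').lt_of_ne fun h => ?_
    have hsI : s ∈ Icc 0 y := ⟨hs.1.le, hs.2.le.trans hxI.2⟩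
    have : x ≤ s := hmin ⟨hsI, by
      change Φ s = c.toReal
      rw [hΦF s hsI]
      exact congrArg ENNReal.toReal h⟩
    exact absurd hs.2 (not_lt.2 this)

/-- Bound s - 1 of the s factors of each term by the whole sum. With s = q/p this is where p ≤ q
enters Hardy's inequality for finite q. -/
theorem tsum_rpow_le_rpow_tsum {ι : Type*} (G : ι → ℝ≥0∞) {s : ℝ} (hs : 1 ≤ s) :
    ∑' i, G i ^ s ≤ (∑' i, G i) ^ s := by
  have h : ∀ x : ℝ≥0∞, x ^ s = x * x ^ (s - 1) := fun x => by
    conv_lhs => rw [show s = 1 + (s - 1) by ring]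
    rw [ENNReal.rpow_add_of_nonneg _ _ zero_le_one (by linarith), ENNReal.rpow_one]
  rw [h (∑' i, G i), ← ENNReal.tsum_mul_right]
  refine ENNReal.tsum_le_tsum fun i => ?_
  rw [h (G i)]
  exact mul_le_mul_right (ENNReal.rpow_le_rpow (ENNReal.le_tsum i) (by linarith)) _

section Upper

variable {p q : ℝ≥0∞} {u v : ℝ → ℝ} {a f : ℝ → ℂ} {k : ℕ}

/-- The primitive `∫_0^x |t^k f(t)| dt`. -/
noncomputable def absMoment (k : ℕ) (f : ℝ → ℂ) (x : ℝ) : ℝ≥0∞ := ∫⁻ t in Ioo 0 x, ‖(t : ℂ) ^ k * f t‖ₑ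

theorem absMoment_mono (k : ℕ) (f : ℝ → ℂ) : Monotone (absMoment k f) := fun _ _ hab =>
  lintegral_mono_set (Ioo_subset_Ioo_right hab)

theorem absMoment_lt_top (hp : 1 < p) (hu : AEMeasurable u halfLine)
    (hd : ∀ r : ℝ, 0 < r → dualIntegral p u 0 r < ∞)
    (hf : AEStronglyMeasurable f halfLine) (hfu : weightedNorm p u f < ∞) {x : ℝ} (hx : 0 < x) :
    absMoment k f x < ∞ := by
  refine (lintegral_pow_mul_le hp hu (ae_pos_of_dualIntegral_lt_top hp hu hd) hf k
    subset_rfl).trans_lt (ENNReal.mul_lt_top ?_ ?_)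
  · exact (eLpNorm_mono_measure _
      (Measure.restrict_mono Ioo_subset_Ioi_self le_rfl)).trans_lt hfu
  · exact ENNReal.rpow_lt_top_of_nonneg (by have := conjExp_pos hp; positivity)
      (dualIntegral_lt_top hp k (hd x hx)).ne

/-- Hardy's inequality on one level set of the primitive. -/
theorem eLpNorm_level_le (hp : 1 < p) (hu : AEMeasurable u halfLine)
    (hd : ∀ r : ℝ, 0 < r → dualIntegral p u 0 r < ∞)
    (hf : AEStronglyMeasurable f halfLine) (hfu : weightedNorm p u f < ∞)
    {c : ℝ≥0∞} (hc : 0 < c) (hct : c ≠ ∞) :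
    eLpNorm (fun x => (v x : ℂ) * summandOp a k f x) q
        (volume.restrict {t | 0 < t ∧ absMoment k f t ∈ Ioc c (2 * c)}) ≤
      4 * hardyConst p q u v a k * eLpNorm (fun x => (u x : ℂ) * f x) p
        (volume.restrict {t | 0 < t ∧ absMoment k f t ∈ Ico (c / 2) c}) := by
  rcases eq_empty_or_nonempty {t | 0 < t ∧ absMoment k f t ∈ Ioc c (2 * c)} with hE | ⟨y, hy⟩
  · rw [hE]; simp
  have hg : AEMeasurable (fun t : ℝ => ‖(t : ℂ) ^ k * f t‖ₑ) halfLine := by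
    refine (AEStronglyMeasurable.mul ?_ hf).enorm
    exact (Complex.measurable_ofReal.pow_const k).aestronglyMeasurable
  have hpos := ae_pos_of_dualIntegral_lt_top hp hu hd
  obtain ⟨x, hx, hxc, hxlt⟩ := exists_primitive_eq hg hy.1
    (absMoment_lt_top hp hu hd hf hfu hy.1).ne hc hy.2.1
  have hhalf : c / 2 < c := ENNReal.half_lt_self hc.ne' hct
  have hx0 : 0 < x := hx.1
  obtain ⟨x', hx', hxc', -⟩ := exists_primitive_eq hg hx.1
    (by rw [hxc]; exact hct) (c := c / 2) (ENNReal.half_pos hc.ne') (by rw [hxc]; exact hhalf)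
  set H := {t | 0 < t ∧ absMoment k f t ∈ Ico (c / 2) c}
  set E := {t | 0 < t ∧ absMoment k f t ∈ Ioc c (2 * c)}
  have hmono := absMoment_mono k f
  have hHx : H ⊆ Ioo 0 x := fun t ht => ⟨ht.1, by
    by_contra h
    have h1 : absMoment k f x ≤ absMoment k f t := hmono (not_lt.1 h)
    rw [absMoment, hxc] at h1
    exact absurd ht.2.2 (not_lt.2 h1)⟩
  have hEx : E ⊆ Ioi x := fun t ht => by
    by_contra h
    have h1 : absMoment k f t ≤ absMoment k f x := hmono (not_lt.1 h)
    rw [absMoment, absMoment, hxc] at h1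
    exact absurd ht.2.1 (not_lt.2 h1)
  have hIH : Ico x' x ⊆ H := fun t ht => by
    have ht0 : 0 < t := hx'.1.trans_le ht.1
    refine ⟨ht0, ?_, hxlt t ⟨ht0, ht.2⟩⟩
    rw [← hxc']
    exact hmono ht.1
  -- From x' to x the primitive climbs from c/2 to c, and [x', x) lies in H.
  have hhalfle : c / 2 ≤ ∫⁻ t in H, ‖(t : ℂ) ^ k * f t‖ₑ := by
    refine le_trans ?_ (lintegral_mono_set hIH)
    have hun : Ioo 0 x ⊆ Ioo 0 x' ∪ Ico x' x := by
      intro t ht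
      rcases lt_or_ge t x' with h | h
      · exact Or.inl ⟨ht.1, h⟩
      · exact Or.inr ⟨h, ht.2⟩
    have h1 := (lintegral_mono_set (μ := volume) (f := fun t : ℝ => ‖(t : ℂ) ^ k * f t‖ₑ)
      hun).trans (lintegral_union_le _ _ _)
    rw [hxc, hxc'] at h1
    conv_lhs at h1 => rw [← ENNReal.add_halves c]
    exact (ENNReal.add_le_add_iff_left (hhalf.trans hct.lt_top).ne).1 h1
  have hhold := lintegral_pow_mul_le hp hu hpos hf k hHx
  have hA : eLpNorm (fun x => (v x : ℂ) * summandOp a k f x) q (volume.restrict E) ≤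
      2 * c * eLpNorm (fun x => a x * (v x : ℂ)) q (volume.restrict (Ioi x)) := by
    refine le_trans ?_ (mul_le_mul_right (eLpNorm_mono_measure _
      (Measure.restrict_mono hEx le_rfl)) _)
    have hct2 : 2 * c ≠ ∞ := ENNReal.mul_ne_top (by simp) hct
    lift c to ℝ≥0 using hct
    have : (2 : ℝ≥0∞) * c = ((2 * c : ℝ≥0) : ℝ≥0∞) := by push_cast; rfl
    rw [this]
    refine eLpNorm_le_nnreal_smul_eLpNorm_of_ae_le_mul' ?_ q
    have hEm : MeasurableSet E :=
      measurableSet_Ioi.inter (hmono.measurable measurableSet_Ioc)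
    filter_upwards [ae_restrict_mem hEm] with t ht
    rw [← this, summandOp, show (v t : ℂ) * (a t * moment k f t) =
      moment k f t * (a t * v t) by ring, enorm_mul]
    gcongr
    exact (enorm_integral_le_lintegral_enorm _).trans ht.2.2
  refine hA.trans ?_
  -- The moment is at most 2c on E, while Hölder controls the increment c/2 on H: the ratio is the
  -- constant 4.
  have h4 : 2 * c = 4 * (c / 2) := by
    rw [show (4 : ℝ≥0∞) = 2 * 2 by norm_num, mul_assoc, ENNReal.mul_div_cancel (by simp) (by simp)]
  rw [h4]
  have hS : eLpNorm (fun x => a x * (v x : ℂ)) q (volume.restrict (Ioi x)) *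
      dualIntegral p u (k * conjExp p) x ^ (1 / conjExp p) ≤ hardyConst p q u v a k :=
    le_iSup₂_of_le x hx0 le_rfl
  calc 4 * (c / 2) * eLpNorm (fun x => a x * (v x : ℂ)) q (volume.restrict (Ioi x))
      ≤ 4 * (eLpNorm (fun x => (u x : ℂ) * f x) p (volume.restrict H) *
          dualIntegral p u (k * conjExp p) x ^ (1 / conjExp p)) *
          eLpNorm (fun x => a x * (v x : ℂ)) q (volume.restrict (Ioi x)) := by
        gcongr
        exact hhalfle.trans hhold
    _ = 4 * (eLpNorm (fun x => a x * (v x : ℂ)) q (volume.restrict (Ioi x)) *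
          dualIntegral p u (k * conjExp p) x ^ (1 / conjExp p)) *
          eLpNorm (fun x => (u x : ℂ) * f x) p (volume.restrict H) := by ring
    _ ≤ _ := by gcongr

theorem exists_mem_Ioc_two_zpow {x : ℝ≥0∞} (hx : x ≠ 0) (hx' : x ≠ ∞) :
    ∃ j : ℤ, x ∈ Ioc ((2 : ℝ≥0∞) ^ j) (2 * 2 ^ j) := by
  obtain ⟨j, hj⟩ := ENNReal.exists_mem_Ioc_zpow hx hx' (y := 2) (by norm_num) (by simp)
  refine ⟨j, ?_⟩
  rwa [ENNReal.zpow_add (by simp) (by simp), zpow_one, mul_comm] at hj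

/-- The weighted Hardy inequality for `1 < p ≤ q ≤ ∞`, with the constant `4`. -/
theorem weightedNorm_summandOp_le (hp : 1 < p) (hpq : p ≤ q) (hu : AEMeasurable u halfLine)
    (hd : ∀ r : ℝ, 0 < r → dualIntegral p u 0 r < ∞)
    (hf : AEStronglyMeasurable f halfLine) (hfu : weightedNorm p u f < ∞) :
    weightedNorm q v (summandOp a k f) ≤ 4 * hardyConst p q u v a k * weightedNorm p u f := by
  set F := absMoment k f with hF
  have hmono : Monotone F := absMoment_mono k f
  set E : ℤ → Set ℝ := fun j => {t | 0 < t ∧ F t ∈ Ioc ((2 : ℝ≥0∞) ^ j) (2 * 2 ^ j)} with hE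
  set H : ℤ → Set ℝ := fun j => {t | 0 < t ∧ F t ∈ Ico ((2 : ℝ≥0∞) ^ j / 2) (2 ^ j)} with hH
  set Z : Set ℝ := {t | 0 < t ∧ F t = 0} with hZ
  have hEm : ∀ j, MeasurableSet (E j) := fun j =>
    measurableSet_Ioi.inter (hmono.measurable measurableSet_Ioc)
  have hHm : ∀ j, MeasurableSet (H j) := fun j =>
    measurableSet_Ioi.inter (hmono.measurable measurableSet_Ico)
  have hZm : MeasurableSet Z :=
    measurableSet_Ioi.inter (hmono.measurable (measurableSet_singleton 0))
  have hcover : Ioi (0 : ℝ) ⊆ Z ∪ ⋃ j, E j := by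
    intro t ht
    by_cases h0 : F t = 0
    · exact Or.inl ⟨ht, h0⟩
    · obtain ⟨j, hj⟩ := exists_mem_Ioc_two_zpow h0 (absMoment_lt_top hp hu hd hf hfu ht).ne
      exact Or.inr (mem_iUnion.2 ⟨j, ht, hj⟩)
  have hzero : ∀ t ∈ Z, (v t : ℂ) * summandOp a k f t = 0 := by
    intro t ht
    have : ‖moment k f t‖ₑ ≤ 0 := (enorm_integral_le_lintegral_enorm _).trans ht.2.le
    rw [summandOp, enorm_eq_zero.1 (le_antisymm this bot_le)]
    simp
  have hlev : ∀ j : ℤ, eLpNorm (fun x => (v x : ℂ) * summandOp a k f x) q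
      (volume.restrict (E j)) ≤ 4 * hardyConst p q u v a k *
        eLpNorm (fun x => (u x : ℂ) * f x) p (volume.restrict (H j)) := fun j =>
    eLpNorm_level_le hp hu hd hf hfu (ENNReal.zpow_pos (by simp) (by simp) j)
      (ENNReal.zpow_ne_top (by simp) (by simp) j)
  have hHI : ∀ j, H j ⊆ Ioi 0 := fun j t ht => ht.1
  set S := 4 * hardyConst p q u v a k with hS
  by_cases hq : q = ∞
  · subst hq
    rw [weightedNorm, eLpNorm_exponent_top]
    refine eLpNormEssSup_le_of_ae_enorm_bound ?_
    suffices h : ∀ᵐ x ∂(volume.restrict (Z ∪ ⋃ j, E j)),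
        ‖(v x : ℂ) * summandOp a k f x‖ₑ ≤ S * weightedNorm p u f from
      ae_mono (Measure.restrict_mono hcover le_rfl) h
    rw [ae_restrict_union_iff, ae_restrict_iUnion_iff]
    constructor
    · filter_upwards [ae_restrict_mem hZm] with t ht
      rw [hzero t ht]
      simp
    · intro j
      have h1 := hlev j
      rw [eLpNorm_exponent_top] at h1
      have h2 : eLpNorm (fun x => (u x : ℂ) * f x) p (volume.restrict (H j)) ≤
        weightedNorm p u f := eLpNorm_mono_measure _ (Measure.restrict_mono (hHI j) le_rfl)
      filter_upwards [ae_le_eLpNormEssSup (f := fun x => (v x : ℂ) * summandOp a k f x)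
        (μ := volume.restrict (E j))] with t ht
      exact ht.trans (h1.trans (by gcongr))
  have hpt : p ≠ ∞ := fun h => hq (top_le_iff.1 (h ▸ hpq))
  have hp0 : p ≠ 0 := (zero_lt_one.trans hp).ne'
  have hq0 : q ≠ 0 := ((zero_lt_one.trans hp).trans_le hpq).ne'
  have hpr : 0 < p.toReal := ENNReal.toReal_pos hp0 hpt
  have hqr : 0 < q.toReal := ENNReal.toReal_pos hq0 hq
  have hpqr : p.toReal ≤ q.toReal := (ENNReal.toReal_le_toReal hpt hq).2 hpq
  -- Since 2^j / 2 = 2^{j-1}, the half-open levels of the primitive defining the H j do not overlap,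
  -- so the norms of u f on them add up without loss.
  have hdisj : Pairwise (Function.onFun Disjoint H) := by
    have key : ∀ i j : ℤ, i < j → Disjoint (H i) (H j) := by
      intro i j hij
      rw [Set.disjoint_left]
      rintro t ⟨-, -, h1⟩ ⟨-, h2, -⟩
      have h3 : (2 : ℝ≥0∞) ^ i ≤ 2 ^ j / 2 := by
        have : (2 : ℝ≥0∞) ^ j / 2 = 2 ^ (j - 1) := by
          rw [ENNReal.zpow_sub (by simp) (by simp), zpow_one, div_eq_mul_inv]
        rw [this]
        exact ENNReal.zpow_le_of_le (by norm_num) (by omega)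
      exact absurd (h1.trans_le h3) (not_lt.2 h2)
    intro i j hij
    rcases lt_or_gt_of_ne hij with h | h
    · exact key i j h
    · exact (key j i h).symm
  rw [weightedNorm, weightedNorm, eLpNorm_eq_lintegral_rpow_enorm_toReal hq0 hq,
    eLpNorm_eq_lintegral_rpow_enorm_toReal hp0 hpt, one_div, ENNReal.rpow_inv_le_iff hqr]
  calc ∫⁻ x, ‖(v x : ℂ) * summandOp a k f x‖ₑ ^ q.toReal ∂halfLine
      ≤ (∫⁻ x in Z, ‖(v x : ℂ) * summandOp a k f x‖ₑ ^ q.toReal) +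
          ∫⁻ x in ⋃ j, E j, ‖(v x : ℂ) * summandOp a k f x‖ₑ ^ q.toReal :=
        (lintegral_mono_set hcover).trans (lintegral_union_le _ _ _)
    _ = ∫⁻ x in ⋃ j, E j, ‖(v x : ℂ) * summandOp a k f x‖ₑ ^ q.toReal := by
        rw [setLIntegral_congr_fun (g := fun _ => 0) hZm, lintegral_zero, zero_add]
        intro t ht
        simp only [hzero t ht]
        simp [hqr]
    _ ≤ ∑' j, ∫⁻ x in E j, ‖(v x : ℂ) * summandOp a k f x‖ₑ ^ q.toReal :=
        lintegral_iUnion_le _ _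
    _ ≤ ∑' j, S ^ q.toReal *
          (∫⁻ x in H j, ‖(u x : ℂ) * f x‖ₑ ^ p.toReal) ^ (q.toReal / p.toReal) := by
        refine ENNReal.tsum_le_tsum fun j => ?_
        have h1 := hlev j
        rw [eLpNorm_eq_lintegral_rpow_enorm_toReal hq0 hq,
          eLpNorm_eq_lintegral_rpow_enorm_toReal hp0 hpt, one_div,
          ENNReal.rpow_inv_le_iff hqr, ENNReal.mul_rpow_of_nonneg _ _ hqr.le,
          ← ENNReal.rpow_mul] at h1
        rwa [show q.toReal / p.toReal = 1 / p.toReal * q.toReal by ring]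
    _ ≤ S ^ q.toReal * (∑' j, ∫⁻ x in H j, ‖(u x : ℂ) * f x‖ₑ ^ p.toReal) ^
          (q.toReal / p.toReal) := by
        rw [ENNReal.tsum_mul_left]
        gcongr
        exact tsum_rpow_le_rpow_tsum _ ((one_le_div hpr).2 hpqr)
    _ ≤ S ^ q.toReal * (∫⁻ x, ‖(u x : ℂ) * f x‖ₑ ^ p.toReal ∂halfLine) ^
          (q.toReal / p.toReal) := by
        gcongr
        rw [← lintegral_iUnion hHm hdisj]
        exact lintegral_mono_set (iUnion_subset hHI)
    _ = _ := by
        rw [ENNReal.mul_rpow_of_nonneg S _ hqr.le, ← ENNReal.rpow_mul]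
        congr 2
        ring

end Upper

/-! ### Doubling and the removal of dyadic intervals. -/

/-- The union of the dyadic intervals `[b, 2b)`, `b ∈ A`. -/
def dyadicUnion (A : Finset ℝ) : Set ℝ := ⋃ b ∈ A, Ico b (2 * b)

theorem mem_dyadicUnion {A : Finset ℝ} {t : ℝ} :
    t ∈ dyadicUnion A ↔ ∃ b ∈ A, b ≤ t ∧ t < 2 * b := by
  simp only [dyadicUnion, mem_iUnion, mem_Ico, exists_prop]

theorem measurableSet_dyadicUnion (A : Finset ℝ) : MeasurableSet (dyadicUnion A) :=
  A.measurableSet_biUnion fun _ _ => measurableSet_Ico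

/-- A doubling density gives a comparable mass to the complement of finitely many dyadic
intervals. -/
theorem lintegral_le_diff_dyadicUnion {φ : ℝ → ℝ≥0∞} {D : ℝ≥0∞} (hD : 1 ≤ D)
    (hφ : ∀ r : ℝ, 0 < r → ∫⁻ t in Ioo 0 (2 * r), φ t ≤ D * ∫⁻ t in Ioo 0 r, φ t)
    (A : Finset ℝ) : ∀ a : ℝ,
    ∫⁻ t in Ioo 0 a, φ t ≤ D ^ A.card * ∫⁻ t in Ioo 0 a \ dyadicUnion A, φ t := by
  induction A using Finset.strongInduction with
  | H A ih =>
    intro a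
    have hDA : ∀ m : ℕ, 1 ≤ D ^ m := fun m => one_le_pow₀ hD
    rcases (A.filter fun b => 0 < b ∧ b < a).eq_empty_or_nonempty with h0 | hne
    · have hsub : Ioo 0 a ⊆ Ioo 0 a \ dyadicUnion A := by
        intro t ht
        refine ⟨ht, fun hmem => ?_⟩
        obtain ⟨b, hb, h1, h2⟩ := mem_dyadicUnion.1 hmem
        have : b ∈ A.filter fun b => 0 < b ∧ b < a :=
          Finset.mem_filter.2 ⟨hb, by linarith, h1.trans_lt ht.2⟩
        simp [h0] at this
      exact (lintegral_mono_set hsub).trans (le_mul_of_one_le_left bot_le (hDA _))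
    -- For the largest relevant b, no removed interval meets [2b, a), so that piece is kept whole.
    -- One doubling moves (0, 2b) to (0, b), where [b, 2b) plays no role and induction applies to A
    -- without b.
    · obtain ⟨b, hb, hmax⟩ := Finset.exists_max_image _ id hne
      obtain ⟨hbA, hb0, hba⟩ := Finset.mem_filter.1 hb
      have hih := ih (A.erase b) (Finset.erase_ssubset hbA) b
      have hcard : A.card = (A.erase b).card + 1 := (Finset.card_erase_add_one hbA).symm
      have hsplit : Ioo 0 a ⊆ Ioo 0 (2 * b) ∪ (Ioo 0 a ∩ Ici (2 * b)) := by
        intro t ht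
        rcases lt_or_ge t (2 * b) with h | h
        · exact Or.inl ⟨ht.1, h⟩
        · exact Or.inr ⟨ht, h⟩
      have hsub : (Ioo 0 b \ dyadicUnion (A.erase b)) ∪ (Ioo 0 a ∩ Ici (2 * b)) ⊆
          Ioo 0 a \ dyadicUnion A := by
        rintro t (⟨ht, htn⟩ | ⟨ht, htb⟩)
        · refine ⟨⟨ht.1, ht.2.trans hba⟩, fun hmem => ?_⟩
          obtain ⟨d, hd, h1, h2⟩ := mem_dyadicUnion.1 hmem
          refine htn (mem_dyadicUnion.2 ⟨d, Finset.mem_erase.2 ⟨?_, hd⟩, h1, h2⟩)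
          exact (h1.trans_lt ht.2).ne
        · refine ⟨ht, fun hmem => ?_⟩
          obtain ⟨d, hd, h1, h2⟩ := mem_dyadicUnion.1 hmem
          have : d ≤ b := hmax d (Finset.mem_filter.2 ⟨hd, by linarith [ht.1], h1.trans_lt ht.2⟩)
          have htb : 2 * b ≤ t := htb
          linarith
      have hdisj : Disjoint (Ioo 0 b \ dyadicUnion (A.erase b)) (Ioo 0 a ∩ Ici (2 * b)) := by
        rw [Set.disjoint_left]
        rintro t ⟨ht, -⟩ ⟨-, htb⟩
        have htb : 2 * b ≤ t := htb
        linarith [ht.2]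
      calc ∫⁻ t in Ioo 0 a, φ t
          ≤ (∫⁻ t in Ioo 0 (2 * b), φ t) + ∫⁻ t in Ioo 0 a ∩ Ici (2 * b), φ t :=
            (lintegral_mono_set hsplit).trans (lintegral_union_le _ _ _)
        _ ≤ D * (D ^ (A.erase b).card * ∫⁻ t in Ioo 0 b \ dyadicUnion (A.erase b), φ t) +
              D ^ A.card * ∫⁻ t in Ioo 0 a ∩ Ici (2 * b), φ t := by
            gcongr
            · exact (hφ b hb0).trans (by gcongr)
            · exact le_mul_of_one_le_left bot_le (hDA _)
        _ = D ^ A.card * ((∫⁻ t in Ioo 0 b \ dyadicUnion (A.erase b), φ t) +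
              ∫⁻ t in Ioo 0 a ∩ Ici (2 * b), φ t) := by
            rw [hcard]
            ring
        _ = D ^ A.card * ∫⁻ t in (Ioo 0 b \ dyadicUnion (A.erase b)) ∪
              (Ioo 0 a ∩ Ici (2 * b)), φ t := by
            rw [lintegral_union (measurableSet_Ioo.inter measurableSet_Ici) hdisj]
        _ ≤ _ := by
            gcongr

/-! ### Control of the coefficients of a polynomial by its weighted mean. -/

/-- The majorant `∏ (t + |z|)` of `∏ |t - z|`. -/
noncomputable def rootMajorant (Z : Multiset ℂ) (t : ℝ) : ℝ := (Z.map fun z => t + ‖z‖).prod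

theorem rootMajorant_nonneg (Z : Multiset ℂ) {t : ℝ} (ht : 0 ≤ t) : 0 ≤ rootMajorant Z t := by
  refine Multiset.prod_nonneg fun y hy => ?_
  obtain ⟨z, -, rfl⟩ := Multiset.mem_map.1 hy
  positivity

theorem rootMajorant_cons (ζ : ℂ) (Z : Multiset ℂ) (t : ℝ) :
    rootMajorant (ζ ::ₘ Z) t = (t + ‖ζ‖) * rootMajorant Z t := by
  simp [rootMajorant]

/-- The coefficients of ∏ (X - z) are dominated by those of ∏ (X + |z|), and at t ≥ 0 each monomial
of the latter is at most its value. -/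
theorem norm_coeff_mul_pow_le_rootMajorant (Z : Multiset ℂ) {t : ℝ} (ht : 0 ≤ t) (k : ℕ) :
    ‖(Z.map fun z => Polynomial.X - Polynomial.C z).prod.coeff k‖ * t ^ k ≤ rootMajorant Z t := by
  induction Z using Multiset.induction generalizing k with
  | empty =>
    rcases k with _ | k
    · simp [rootMajorant]
    · simp [rootMajorant, Polynomial.coeff_one]
  | cons ζ Z ih =>
    rw [rootMajorant_cons, Multiset.map_cons, Multiset.prod_cons, sub_mul, Polynomial.coeff_sub,
      Polynomial.coeff_C_mul]
    set P := (Z.map fun z => Polynomial.X - Polynomial.C z).prod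
    have h1 : ‖(Polynomial.X * P).coeff k‖ * t ^ k ≤ t * rootMajorant Z t := by
      rcases k with _ | k
      · simpa using mul_nonneg ht (rootMajorant_nonneg Z ht)
      · rw [Polynomial.coeff_X_mul, pow_succ]
        nlinarith [ih k]
    have h2 : ‖ζ * P.coeff k‖ * t ^ k ≤ ‖ζ‖ * rootMajorant Z t := by
      rw [norm_mul, mul_assoc]
      exact mul_le_mul_of_nonneg_left (ih k) (norm_nonneg _)
    have h3 := mul_le_mul_of_nonneg_right
      (norm_sub_le ((Polynomial.X * P).coeff k) (ζ * P.coeff k)) (pow_nonneg ht k)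
    linarith

theorem rootMajorant_le_of_forall (Z : Multiset ℂ) {t : ℝ} (ht : 0 ≤ t)
    (h : ∀ z ∈ Z, t + ‖z‖ ≤ 7 * ‖(t : ℂ) - z‖) :
    rootMajorant Z t ≤ 7 ^ Multiset.card Z * (Z.map fun z => ‖(t : ℂ) - z‖).prod := by
  induction Z using Multiset.induction with
  | empty => simp [rootMajorant]
  | cons ζ Z ih =>
    rw [rootMajorant_cons, Multiset.map_cons, Multiset.prod_cons, Multiset.card_cons, pow_succ]
    have h1 := h ζ (Multiset.mem_cons_self _ _)
    have h2 := ih fun z hz => h z (Multiset.mem_cons_of_mem hz)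
    calc _ ≤ (7 * ‖(t : ℂ) - ζ‖) *
          (7 ^ Multiset.card Z * (Z.map fun z => ‖(t : ℂ) - z‖).prod) :=
          mul_le_mul h1 h2 (rootMajorant_nonneg Z ht) (by positivity)
      _ = _ := by ring

theorem rootMajorant_mono (Z : Multiset ℂ) {x y : ℝ} (hx : 0 ≤ x) (hxy : x ≤ y) :
    rootMajorant Z x ≤ rootMajorant Z y := by
  induction Z using Multiset.induction with
  | empty => simp [rootMajorant]
  | cons ζ Z ih =>
    rw [rootMajorant_cons, rootMajorant_cons]
    exact mul_le_mul (by linarith) ih (rootMajorant_nonneg Z hx)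
      (add_nonneg (hx.trans hxy) (norm_nonneg _))

theorem rootMajorant_le_pow_mul (Z : Multiset ℂ) {c t : ℝ} (ht : 0 ≤ t) (hc : 1 ≤ c) :
    rootMajorant Z (c * t) ≤ c ^ Multiset.card Z * rootMajorant Z t := by
  induction Z using Multiset.induction with
  | empty => simp [rootMajorant]
  | cons ζ Z ih =>
    rw [rootMajorant_cons, rootMajorant_cons, Multiset.card_cons, pow_succ]
    have h1 : c * t + ‖ζ‖ ≤ c * (t + ‖ζ‖) := by nlinarith [norm_nonneg ζ]
    calc _ ≤ (c * (t + ‖ζ‖)) * (c ^ Multiset.card Z * rootMajorant Z t) :=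
          mul_le_mul h1 ih (rootMajorant_nonneg Z (by positivity)) (by positivity)
      _ = _ := by ring

/-- Near the modulus of a root, the growth of the majorant has one power less than its degree. -/
theorem rootMajorant_two_mul_mul_pow_le {Z : Multiset ℂ} {n : ℕ} (hZ : Multiset.card Z ≤ n + 1)
    {ζ : ℂ} (hζ : ζ ∈ Z) {a t : ℝ} (ha : a = 2 * ‖ζ‖ / 3) (ht : 0 < t) (hta : t ≤ a) :
    rootMajorant Z (2 * a) * (t / a) ^ n ≤ 4 * 2 ^ n * rootMajorant Z t := by
  have ha0 : 0 < a := ht.trans_le hta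
  obtain ⟨Z', rfl⟩ := Multiset.exists_cons_of_mem hζ
  rw [Multiset.card_cons] at hZ
  rw [rootMajorant_cons, rootMajorant_cons]
  -- The factor of ζ varies only by a bounded ratio on (0, 2a]; the at most n others account for the
  -- power n.
  have h1 : 2 * a + ‖ζ‖ ≤ 4 * (t + ‖ζ‖) := by linarith
  have hc : 1 ≤ 2 * a / t := by
    rw [le_div_iff₀ ht]; linarith
  have h2 : rootMajorant Z' (2 * a) ≤ (2 * a / t) ^ n * rootMajorant Z' t := by
    have h := rootMajorant_le_pow_mul Z' ht.le hc
    rw [div_mul_cancel₀ _ ht.ne'] at h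
    refine h.trans (mul_le_mul_of_nonneg_right ?_ (rootMajorant_nonneg _ ht.le))
    exact pow_le_pow_right₀ hc (by omega)
  have h3 : (2 * a / t) ^ n * (t / a) ^ n = 2 ^ n := by
    rw [← mul_pow]; congr 1; field_simp
  calc (2 * a + ‖ζ‖) * rootMajorant Z' (2 * a) * (t / a) ^ n
      ≤ (4 * (t + ‖ζ‖)) * ((2 * a / t) ^ n * rootMajorant Z' t) * (t / a) ^ n := by
        have := rootMajorant_nonneg Z' (t := 2 * a) (by positivity)
        gcongr
    _ = 4 * (t + ‖ζ‖) * ((2 * a / t) ^ n * (t / a) ^ n) * rootMajorant Z' t := by ring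
    _ = _ := by rw [h3]; ring

/-- Compare |t - z| with |t - |z||. The worst ratios (t + |z|) / |t - |z|| are 5 at t = 2|z|/3 and 7
at t = 4|z|/3. -/
theorem add_norm_le_of_notMem_Ico {z : ℂ} {t : ℝ} (ht : 0 < t)
    (h : t ∉ Ico (2 * ‖z‖ / 3) (2 * (2 * ‖z‖ / 3))) : t + ‖z‖ ≤ 7 * ‖(t : ℂ) - z‖ := by
  have h1 : |t - ‖z‖| ≤ ‖(t : ℂ) - z‖ := by
    have := abs_norm_sub_norm_le (t : ℂ) z
    rwa [Complex.norm_of_nonneg ht.le] at this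
  rw [abs_le'] at h1
  rw [mem_Ico, not_and_or, not_le, not_lt] at h
  rcases h with h | h <;> linarith [norm_nonneg z]

/-- Under the doubling condition of order `n - 1`, the majorant of a product of at most `n` linear
factors is controlled by the product in the mean. -/
theorem lintegral_rootMajorant_le {e : ℝ} (he : 0 < e) {n : ℕ} {Z : Multiset ℂ}
    (hZ : Multiset.card Z ≤ n) {D : ℝ≥0∞} (hD : 1 ≤ D) {w : ℝ → ℝ≥0∞}
    (hw : ∀ r : ℝ, 0 < r →
      ∫⁻ t in Ioo 0 (2 * r), ENNReal.ofReal t ^ (((n : ℝ) - 1) * e) * w t ≤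
        D * ∫⁻ t in Ioo 0 r, ENNReal.ofReal t ^ (((n : ℝ) - 1) * e) * w t) (r : ℝ) :
    ∫⁻ t in Ioo 0 r, ENNReal.ofReal (rootMajorant Z t) ^ e * w t ≤
      (1 + n * (D ^ (n + 1) * ENNReal.ofReal (4 * 2 ^ (n - 1)) ^ e)) *
        ∫⁻ t in Ioo 0 r,
          ENNReal.ofReal (7 ^ n * (Z.map fun z => ‖(t : ℂ) - z‖).prod) ^ e * w t := by
  set A : Finset ℝ := (Z.map fun z => 2 * ‖z‖ / 3).toFinset with hA
  have hAcard : A.card ≤ n :=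
    (Multiset.toFinset_card_le _).trans (by rwa [Multiset.card_map])
  set I := ∫⁻ t in Ioo 0 r,
    ENNReal.ofReal (7 ^ n * (Z.map fun z => ‖(t : ℂ) - z‖).prod) ^ e * w t
  set U := dyadicUnion A
  have hUm : MeasurableSet U := measurableSet_dyadicUnion A
  set K : ℝ≥0∞ := D ^ (n + 1) * ENNReal.ofReal (4 * 2 ^ (n - 1)) ^ e
  have hgood : ∫⁻ t in Ioo 0 r \ U, ENNReal.ofReal (rootMajorant Z t) ^ e * w t ≤ I := by
    refine le_trans (setLIntegral_mono' (measurableSet_Ioo.diff hUm) fun t ht => ?_)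
      (lintegral_mono_set sdiff_subset)
    gcongr
    refine (rootMajorant_le_of_forall Z ht.1.1.le fun z hz => ?_).trans ?_
    · refine add_norm_le_of_notMem_Ico ht.1.1 fun hmem => ht.2 (mem_dyadicUnion.2 ⟨_, ?_, hmem⟩)
      exact Multiset.mem_toFinset.2 (Multiset.mem_map_of_mem _ hz)
    · refine mul_le_mul_of_nonneg_right (pow_le_pow_right₀ (by norm_num) hZ) ?_
      refine Multiset.prod_nonneg fun y hy => ?_
      obtain ⟨z, -, rfl⟩ := Multiset.mem_map.1 hy
      positivity
  have hbad : ∀ b ∈ A, ∫⁻ t in Ioo 0 r ∩ Ico b (2 * b),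
      ENNReal.ofReal (rootMajorant Z t) ^ e * w t ≤ K * I := by
    intro b hb
    obtain ⟨ζ, hζ, hζb⟩ := Multiset.mem_map.1 (Multiset.mem_toFinset.1 hb)
    have hb0' : 0 ≤ b := by rw [← hζb]; positivity
    rcases eq_empty_or_nonempty (Ioo 0 r ∩ Ico b (2 * b)) with h0 | ⟨y, hy⟩
    · rw [h0]; simp
    have hb0 : 0 < b := by
      by_contra h
      have : b = 0 := le_antisymm (not_lt.1 h) hb0'
      have := hy.2.1
      have := hy.2.2
      linarith
    have hbr : b < r := hy.2.1.trans_lt hy.1.2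
    -- A root exists, so n ≥ 1 and the truncated n - 1 in the constant agrees with the real exponent
    -- in the doubling condition. For n = 0 there are no bad intervals.
    obtain ⟨m, rfl⟩ : ∃ m, n = m + 1 := by
      refine Nat.exists_eq_succ_of_ne_zero ?_
      have := Multiset.card_pos_iff_exists_mem.2 ⟨ζ, hζ⟩
      omega
    simp only [Nat.cast_add, Nat.cast_one, add_sub_cancel_right] at hw
    -- The monomial c t^m is at least the majorant on [b, 2b), and at most 4·2^m times the majorant
    -- on (0, b). It is the intermediary to which doubling of order m = n - 1 applies.
    set c : ℝ := rootMajorant Z (2 * b) * (1 / b) ^ m with hc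
    have hQ0 : 0 ≤ rootMajorant Z (2 * b) := rootMajorant_nonneg Z (by positivity)
    have hc0 : 0 ≤ c := by positivity
    have hpow : ∀ t : ℝ, 0 < t → ENNReal.ofReal (c * t ^ m) ^ e * w t =
        ENNReal.ofReal c ^ e * (ENNReal.ofReal t ^ (m * e) * w t) := by
      intro t ht
      rw [ENNReal.ofReal_mul hc0, ENNReal.mul_rpow_of_nonneg _ _ he.le, ENNReal.ofReal_pow ht.le,
        ENNReal.rpow_natCast_mul, mul_assoc]
    have hcfin : ENNReal.ofReal c ^ e ≠ ∞ :=
      (ENNReal.rpow_lt_top_of_nonneg he.le (by simp)).ne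
    calc ∫⁻ t in Ioo 0 r ∩ Ico b (2 * b), ENNReal.ofReal (rootMajorant Z t) ^ e * w t
        ≤ ∫⁻ t in Ioo 0 r ∩ Ico b (2 * b), ENNReal.ofReal (c * t ^ m) ^ e * w t := by
          refine setLIntegral_mono' (measurableSet_Ioo.inter measurableSet_Ico) fun t ht => ?_
          gcongr
          refine (rootMajorant_mono Z ht.1.1.le ht.2.2.le).trans ?_
          rw [hc, mul_assoc, ← mul_pow]
          refine le_mul_of_one_le_right hQ0 (one_le_pow₀ ?_)
          rw [one_div, inv_mul_eq_div, le_div_iff₀ hb0]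
          linarith [ht.2.1]
      _ ≤ ∫⁻ t in Ioo 0 (2 * b), ENNReal.ofReal (c * t ^ m) ^ e * w t :=
          lintegral_mono_set fun t ht => ⟨ht.1.1, ht.2.2⟩
      _ = ENNReal.ofReal c ^ e * ∫⁻ t in Ioo 0 (2 * b), ENNReal.ofReal t ^ (m * e) * w t := by
          rw [← lintegral_const_mul' _ _ hcfin]
          exact setLIntegral_congr_fun measurableSet_Ioo fun t ht => hpow t ht.1
      -- One factor D passes from (0, 2b) to (0, b); at most n = m + 1 further ones remove the bad
      -- intervals.
      _ ≤ ENNReal.ofReal c ^ e * (D * (D ^ (m + 1) *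
            ∫⁻ t in Ioo 0 b \ U, ENNReal.ofReal t ^ (m * e) * w t)) := by
          gcongr
          refine (hw b hb0).trans ?_
          gcongr
          refine (lintegral_le_diff_dyadicUnion hD hw A b).trans ?_
          gcongr
      _ = D ^ (m + 1 + 1) * ∫⁻ t in Ioo 0 b \ U, ENNReal.ofReal (c * t ^ m) ^ e * w t := by
          rw [setLIntegral_congr_fun (measurableSet_Ioo.diff hUm)
            (fun t ht => hpow t ht.1.1), lintegral_const_mul' _ _ hcfin]
          ring
      _ ≤ D ^ (m + 1 + 1) * ∫⁻ t in Ioo 0 b \ U, ENNReal.ofReal (4 * 2 ^ m) ^ e *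
            (ENNReal.ofReal (rootMajorant Z t) ^ e * w t) := by
          refine mul_le_mul_right ?_ _
          refine setLIntegral_mono' (measurableSet_Ioo.diff hUm) fun t ht => ?_
          rw [← mul_assoc, ← ENNReal.mul_rpow_of_nonneg _ _ he.le,
            ← ENNReal.ofReal_mul (by positivity)]
          gcongr ENNReal.ofReal ?_ ^ e * w t
          have h := rootMajorant_two_mul_mul_pow_le hZ hζ hζb.symm ht.1.1 ht.1.2.le
          rwa [div_eq_mul_one_div t, mul_comm t, mul_pow, ← mul_assoc] at h
      _ = K * ∫⁻ t in Ioo 0 b \ U, ENNReal.ofReal (rootMajorant Z t) ^ e * w t := by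
          rw [lintegral_const_mul' _ _
            (ENNReal.rpow_lt_top_of_nonneg he.le ENNReal.ofReal_ne_top).ne, ← mul_assoc]
          rfl
      _ ≤ K * I := by
          gcongr
          refine (lintegral_mono_set ?_).trans hgood
          exact sdiff_subset_sdiff_left (Ioo_subset_Ioo_right hbr.le)
  have hcover : Ioo 0 r ⊆ (Ioo 0 r \ U) ∪ ⋃ b : A, Ioo 0 r ∩ Ico (b : ℝ) (2 * b) := by
    intro t ht
    by_cases hU : t ∈ U
    · obtain ⟨b, hb, h⟩ := mem_dyadicUnion.1 hU
      exact Or.inr (mem_iUnion.2 ⟨⟨b, hb⟩, ht, h⟩)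
    · exact Or.inl ⟨ht, hU⟩
  calc ∫⁻ t in Ioo 0 r, ENNReal.ofReal (rootMajorant Z t) ^ e * w t
      ≤ (∫⁻ t in Ioo 0 r \ U, ENNReal.ofReal (rootMajorant Z t) ^ e * w t) +
          ∫⁻ t in ⋃ b : A, Ioo 0 r ∩ Ico (b : ℝ) (2 * b),
            ENNReal.ofReal (rootMajorant Z t) ^ e * w t :=
        (lintegral_mono_set hcover).trans (lintegral_union_le _ _ _)
    _ ≤ I + ∑' b : A, K * I := by
        gcongr
        exact (lintegral_iUnion_le _ _).trans (ENNReal.tsum_le_tsum fun b => hbad b b.2)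
    _ = I + A.card * (K * I) := by
        rw [tsum_fintype, Finset.sum_const, Finset.card_univ, Fintype.card_coe, nsmul_eq_mul]
    _ ≤ I + n * (K * I) := by
        gcongr
    _ = _ := by ring

/-- The constant in `lintegral_coeff_le`. -/
noncomputable def coeffConst (e : ℝ) (n : ℕ) (D : ℝ≥0∞) : ℝ≥0∞ :=
  (1 + n * (D ^ (n + 1) * ENNReal.ofReal (4 * 2 ^ (n - 1)) ^ e)) * ENNReal.ofReal (7 ^ n) ^ e

theorem coeffConst_lt_top {e : ℝ} (he : 0 ≤ e) (n : ℕ) {D : ℝ≥0∞} (hD : D ≠ ∞) :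
    coeffConst e n D < ∞ := by
  have h : ∀ x : ℝ, ENNReal.ofReal x ^ e ≠ ∞ := fun x =>
    (ENNReal.rpow_lt_top_of_nonneg he (by simp)).ne
  refine ENNReal.mul_lt_top ?_ (h _).lt_top
  have h1 := ENNReal.mul_ne_top (ENNReal.pow_ne_top hD (n := n + 1)) (h (4 * 2 ^ (n - 1)))
  exact ENNReal.add_lt_top.2 ⟨by simp, ENNReal.mul_lt_top (by simp) h1.lt_top⟩

/-- Under the doubling condition of order `n - 1`, every monomial of a polynomial of degree at most
`n` is controlled by the polynomial in the mean. -/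
theorem lintegral_coeff_le {e : ℝ} (he : 0 < e) {n : ℕ} {D : ℝ≥0∞} (hD : 1 ≤ D) {w : ℝ → ℝ≥0∞}
    (hw : ∀ r : ℝ, 0 < r →
      ∫⁻ t in Ioo 0 (2 * r), ENNReal.ofReal t ^ (((n : ℝ) - 1) * e) * w t ≤
        D * ∫⁻ t in Ioo 0 r, ENNReal.ofReal t ^ (((n : ℝ) - 1) * e) * w t)
    {P : Polynomial ℂ} (hP : P.natDegree ≤ n) (m : ℕ) (r : ℝ) :
    ‖P.coeff m‖ₑ ^ e * ∫⁻ t in Ioo 0 r, ENNReal.ofReal t ^ (m * e) * w t ≤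
      coeffConst e n D * ∫⁻ t in Ioo 0 r, ‖P.eval (t : ℂ)‖ₑ ^ e * w t := by
  set Z := P.roots
  have hZ : Multiset.card Z ≤ n := (Polynomial.card_roots' P).trans hP
  set ℓ := P.leadingCoeff
  -- This includes P = 0, with ℓ = 0 and no roots.
  have hPZ : P = Polynomial.C ℓ * (Z.map fun z => Polynomial.X - Polynomial.C z).prod :=
    (IsAlgClosed.splits P).eq_prod_roots
  have hfin : ∀ z : ℂ, ‖z‖ₑ ^ e ≠ ∞ := fun z =>
    (ENNReal.rpow_lt_top_of_nonneg he.le (by simp)).ne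
  have heval : ∀ t : ℝ, ‖P.eval (t : ℂ)‖ₑ =
      ‖ℓ‖ₑ * ENNReal.ofReal (Z.map fun z => ‖(t : ℂ) - z‖).prod := by
    intro t
    conv_lhs => rw [hPZ]
    rw [Polynomial.eval_mul, Polynomial.eval_C, Polynomial.eval_multiset_prod, Multiset.map_map,
      enorm_mul, ← ofReal_norm (Multiset.prod _)]
    congr 2
    rw [← coe_nnnorm, ← nnnormHom_apply, map_multiset_prod, Multiset.map_map,
      NNReal.coe_multiset_prod, Multiset.map_map]
    exact congrArg _ (Multiset.map_congr rfl fun z _ => by simp)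
  have hcoeff : ∀ t : ℝ, 0 < t → ‖P.coeff m‖ₑ * ENNReal.ofReal t ^ m ≤
      ‖ℓ‖ₑ * ENNReal.ofReal (rootMajorant Z t) := by
    intro t ht
    conv_lhs => rw [hPZ]
    rw [Polynomial.coeff_C_mul, enorm_mul, mul_assoc, ← ENNReal.ofReal_pow ht.le]
    gcongr
    rw [← ofReal_norm, ← ENNReal.ofReal_mul (norm_nonneg _)]
    exact ENNReal.ofReal_le_ofReal (norm_coeff_mul_pow_le_rootMajorant Z ht.le m)
  calc ‖P.coeff m‖ₑ ^ e * ∫⁻ t in Ioo 0 r, ENNReal.ofReal t ^ (m * e) * w t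
      = ∫⁻ t in Ioo 0 r, ‖P.coeff m‖ₑ ^ e * (ENNReal.ofReal t ^ (m * e) * w t) :=
        (lintegral_const_mul' _ _ (hfin _)).symm
    _ ≤ ∫⁻ t in Ioo 0 r, ‖ℓ‖ₑ ^ e * (ENNReal.ofReal (rootMajorant Z t) ^ e * w t) := by
        refine setLIntegral_mono' measurableSet_Ioo fun t ht => ?_
        rw [← mul_assoc, ← mul_assoc, ENNReal.rpow_natCast_mul,
          ← ENNReal.mul_rpow_of_nonneg _ _ he.le, ← ENNReal.mul_rpow_of_nonneg _ _ he.le]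
        gcongr ?_ ^ e * w t
        exact hcoeff t ht.1
    _ = ‖ℓ‖ₑ ^ e * ∫⁻ t in Ioo 0 r, ENNReal.ofReal (rootMajorant Z t) ^ e * w t :=
        lintegral_const_mul' _ _ (hfin _)
    _ ≤ ‖ℓ‖ₑ ^ e * ((1 + n * (D ^ (n + 1) * ENNReal.ofReal (4 * 2 ^ (n - 1)) ^ e)) *
          ∫⁻ t in Ioo 0 r,
            ENNReal.ofReal (7 ^ n * (Z.map fun z => ‖(t : ℂ) - z‖).prod) ^ e * w t) := by
        gcongr
        exact lintegral_rootMajorant_le he hZ hD hw r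
    _ = (1 + n * (D ^ (n + 1) * ENNReal.ofReal (4 * 2 ^ (n - 1)) ^ e)) *
          ∫⁻ t in Ioo 0 r, ‖ℓ‖ₑ ^ e *
            (ENNReal.ofReal (7 ^ n * (Z.map fun z => ‖(t : ℂ) - z‖).prod) ^ e * w t) := by
        rw [lintegral_const_mul' _ _ (hfin _)]
        ring
    _ = (1 + n * (D ^ (n + 1) * ENNReal.ofReal (4 * 2 ^ (n - 1)) ^ e)) *
          ∫⁻ t in Ioo 0 r, ENNReal.ofReal (7 ^ n) ^ e * (‖P.eval (t : ℂ)‖ₑ ^ e * w t) := by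
        congr 1
        refine lintegral_congr fun t => ?_
        rw [heval, ENNReal.ofReal_mul (by positivity), ENNReal.mul_rpow_of_nonneg _ _ he.le,
          ENNReal.mul_rpow_of_nonneg _ _ he.le]
        ring
    _ = _ := by
        rw [lintegral_const_mul' _ _ (ENNReal.rpow_lt_top_of_nonneg he.le (by simp)).ne,
          coeffConst, mul_assoc]

/-! ### Extremal polynomials and their orthogonality relations. -/

/-- `φ(z) = |z|^{e - 1} z̄ / |z|`, so that `φ(z) z = |z|^e`. -/
noncomputable def dualPower (e : ℝ) (z : ℂ) : ℂ :=
  ((‖z‖ ^ (e - 1) : ℝ) : ℂ) * (starRingEnd ℂ z / (‖z‖ : ℂ))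

theorem norm_dualPower_le (e : ℝ) (z : ℂ) : ‖dualPower e z‖ ≤ ‖z‖ ^ (e - 1) := by
  have h0 : 0 ≤ ‖z‖ ^ (e - 1) := Real.rpow_nonneg (norm_nonneg _) _
  rw [dualPower, norm_mul, norm_div, RCLike.norm_conj, Complex.norm_of_nonneg h0,
    Complex.norm_of_nonneg (norm_nonneg _)]
  exact mul_le_of_le_one_right h0 (div_self_le_one _)

theorem dualPower_mul_self {e : ℝ} (he : 1 ≤ e) (z : ℂ) :
    dualPower e z * z = ((‖z‖ ^ e : ℝ) : ℂ) := by
  rcases eq_or_ne z 0 with rfl | hz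
  · simp [dualPower, Real.zero_rpow (zero_lt_one.trans_le he).ne']
  · have hn : (‖z‖ : ℂ) ≠ 0 := by simpa using hz
    have h : starRingEnd ℂ z * z = (‖z‖ : ℂ) * (‖z‖ : ℂ) := by
      rw [mul_comm, Complex.mul_conj, Complex.normSq_eq_norm_sq]
      push_cast
      ring
    rw [dualPower, mul_assoc, div_mul_eq_mul_div, h, mul_div_assoc, div_self hn, mul_one,
      Real.rpow_sub_one (by simpa using hz)]
    push_cast
    field_simp

theorem measurable_dualPower (e : ℝ) : Measurable (dualPower e) := by
  unfold dualPower
  fun_prop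

/-- For e = 1, that is p = ∞, the dual power jumps at 0. This is harmless because a nonzero
polynomial vanishes only on a null set. -/
theorem continuousAt_dualPower (e : ℝ) {z : ℂ} (hz : z ≠ 0) : ContinuousAt (dualPower e) z := by
  have hn : ‖z‖ ≠ 0 := by simpa using hz
  unfold dualPower
  refine ContinuousAt.mul ?_ (ContinuousAt.div ?_ ?_ (by simpa using hz))
  · exact Complex.continuous_ofReal.continuousAt.comp
      (continuous_norm.continuousAt.rpow_const (Or.inl hn))
  · exact Complex.continuous_conj.continuousAt
  · exact (Complex.continuous_ofReal.comp continuous_norm).continuousAt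

/-- `φ(z)` is a subgradient of `|·|^e / e` at `z`. -/
theorem rpow_norm_sub_le {e : ℝ} (he : 1 ≤ e) (y z : ℂ) :
    ‖z‖ ^ e - ‖y‖ ^ e ≤ e * (dualPower e z * (z - y)).re := by
  have he0 : 0 < e := zero_lt_one.trans_le he
  have h1 : (dualPower e z * y).re ≤ ‖z‖ ^ (e - 1) * ‖y‖ := by
    refine (Complex.re_le_norm _).trans ?_
    rw [norm_mul]
    exact mul_le_mul_of_nonneg_right (norm_dualPower_le e z) (norm_nonneg _)
  -- Young's inequality in weighted form, which admits e = 1.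
  have h2 : ‖z‖ ^ (e - 1) * ‖y‖ ≤ ((e - 1) / e) * ‖z‖ ^ e + (1 / e) * ‖y‖ ^ e := by
    have h := Real.geom_mean_le_arith_mean2_weighted (w₁ := (e - 1) / e) (w₂ := 1 / e)
      (p₁ := ‖z‖ ^ e) (p₂ := ‖y‖ ^ e) (div_nonneg (by linarith) he0.le) (by positivity)
      (by positivity) (by positivity) (by field_simp; ring)
    rw [← Real.rpow_mul (norm_nonneg _), ← Real.rpow_mul (norm_nonneg _)] at h
    rwa [mul_div_cancel₀ _ he0.ne', mul_one_div_cancel he0.ne', Real.rpow_one] at h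
  have h3 : e * (((e - 1) / e) * ‖z‖ ^ e + (1 / e) * ‖y‖ ^ e) = (e - 1) * ‖z‖ ^ e + ‖y‖ ^ e := by
    field_simp
  have h4 := mul_le_mul_of_nonneg_left (h1.trans h2) he0.le
  rw [h3] at h4
  rw [mul_sub, dualPower_mul_self he, Complex.sub_re, Complex.ofReal_re]
  linarith

/-- The polynomial with the coefficients `c 0, …, c n`. -/
noncomputable def coeffPoly {n : ℕ} (c : Fin (n + 1) → ℂ) : Polynomial ℂ :=
  ∑ k : Fin (n + 1), Polynomial.monomial (k : ℕ) (c k)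

theorem coeff_coeffPoly {n : ℕ} (c : Fin (n + 1) → ℂ) (k : Fin (n + 1)) :
    (coeffPoly c).coeff k = c k := by
  simp [coeffPoly, Polynomial.finsetSum_coeff, Polynomial.coeff_monomial, Fin.val_inj]

theorem natDegree_coeffPoly_le {n : ℕ} (c : Fin (n + 1) → ℂ) : (coeffPoly c).natDegree ≤ n := by
  refine Polynomial.natDegree_sum_le_of_forall_le _ _ fun k _ => ?_
  exact (Polynomial.natDegree_monomial_le _).trans (Nat.lt_succ_iff.1 k.2)

theorem eval_coeffPoly {n : ℕ} (c : Fin (n + 1) → ℂ) (z : ℂ) :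
    (coeffPoly c).eval z = ∑ k : Fin (n + 1), c k * z ^ (k : ℕ) := by
  simp [coeffPoly, Polynomial.eval_finsetSum]

theorem ae_eval_ne_zero {μ : Measure ℝ} [NullSingletonClass μ] {P : Polynomial ℂ} (hP : P ≠ 0) :
    ∀ᵐ t : ℝ ∂μ, P.eval (t : ℂ) ≠ 0 := by
  have hfin : {t : ℝ | P.eval (t : ℂ) = 0}.Finite := by
    have h := (Polynomial.finite_setOfPred_isRoot hP).preimage
      (f := fun t : ℝ => (t : ℂ)) Complex.ofReal_injective.injOn
    exact h
  rw [ae_iff]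
  simpa using hfin.measure_zero μ

section Extremal

variable {μ : Measure ℝ} [IsFiniteMeasure μ] {r e : ℝ} {n : ℕ}

theorem integrable_of_continuous_of_ae_mem {E : Type*} [NormedAddCommGroup E]
    (hμ : ∀ᵐ t ∂μ, t ∈ Icc 0 r) {g : ℝ → E} (hg : Continuous g) : Integrable g μ := by
  have h : IntegrableOn g (Icc 0 r) μ := hg.continuousOn.integrableOn_compact isCompact_Icc
  rwa [IntegrableOn, Measure.restrict_eq_self_of_ae_mem hμ] at h

theorem integrable_rpow_norm_eval (hμ : ∀ᵐ t ∂μ, t ∈ Icc 0 r) (he : 1 ≤ e) (P : Polynomial ℂ) :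
    Integrable (fun t : ℝ => ‖P.eval (t : ℂ)‖ ^ e) μ := by
  refine integrable_of_continuous_of_ae_mem hμ ?_
  have : Continuous fun t : ℝ => P.eval (t : ℂ) := P.continuous.comp Complex.continuous_ofReal
  exact this.norm.rpow_const fun _ => Or.inr (by linarith)

theorem integrable_dualPower_mul (hμ : ∀ᵐ t ∂μ, t ∈ Icc 0 r) (he : 1 ≤ e) (P : Polynomial ℂ)
    {h : ℝ → ℂ} (hh : Continuous h) :
    Integrable (fun t : ℝ => dualPower e (P.eval (t : ℂ)) * h t) μ := by
  have hP : Continuous fun t : ℝ => P.eval (t : ℂ) := P.continuous.comp Complex.continuous_ofReal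
  refine Integrable.mono' (g := fun t : ℝ => ‖P.eval (t : ℂ)‖ ^ (e - 1) * ‖h t‖)
    (integrable_of_continuous_of_ae_mem hμ ?_) ?_ ?_
  · exact (hP.norm.rpow_const fun _ => Or.inr (by linarith)).mul hh.norm
  · exact (((measurable_dualPower e).comp hP.measurable).mul hh.measurable).aestronglyMeasurable
  · refine Filter.Eventually.of_forall fun t => ?_
    rw [norm_mul]
    exact mul_le_mul_of_nonneg_right (norm_dualPower_le _ _) (norm_nonneg _)

theorem continuous_integral_rpow_norm_coeffPoly (hμ : ∀ᵐ t ∂μ, t ∈ Icc 0 r) (he : 1 ≤ e) :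
    Continuous fun c : Fin (n + 1) → ℂ => ∫ t, ‖(coeffPoly c).eval (t : ℂ)‖ ^ e ∂μ := by
  have h : Continuous (Function.uncurry fun (c : Fin (n + 1) → ℂ) (t : ℝ) =>
      ‖(coeffPoly c).eval (t : ℂ)‖ ^ e) := by
    simp only [eval_coeffPoly, Function.uncurry_def]
    refine Continuous.rpow_const ?_ fun _ => Or.inr (by linarith)
    fun_prop
  have h' := continuous_parametric_integral_of_continuous (μ := μ) h
    (isCompact_Icc (a := 0) (b := r))
  rwa [Measure.restrict_eq_self_of_ae_mem hμ] at h'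

/-- The bound `hκ` makes the functional coercive in the coefficients, so it may be minimised over a
compact set. -/
theorem exists_minimizer_coeffPoly (hμ : ∀ᵐ t ∂μ, t ∈ Icc 0 r) (he : 1 ≤ e) {κ : ℝ}
    (hκ : ∀ (c : Fin (n + 1) → ℂ) (k : Fin (n + 1)),
      ‖c k‖ ^ e ≤ κ * ∫ t, ‖(coeffPoly c).eval (t : ℂ)‖ ^ e ∂μ) (hκ0 : 0 ≤ κ)
    (m : Fin (n + 1)) :
    ∃ c : Fin (n + 1) → ℂ, c m = 1 ∧ ∀ c' : Fin (n + 1) → ℂ, c' m = 1 →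
      ∫ t, ‖(coeffPoly c).eval (t : ℂ)‖ ^ e ∂μ ≤ ∫ t, ‖(coeffPoly c').eval (t : ℂ)‖ ^ e ∂μ := by
  have he0 : 0 < e := by linarith
  set N : (Fin (n + 1) → ℂ) → ℝ := fun c => ∫ t, ‖(coeffPoly c).eval (t : ℂ)‖ ^ e ∂μ
  have hN0 : ∀ c, 0 ≤ N c := fun c => integral_nonneg fun t => by positivity
  set c₀ : Fin (n + 1) → ℂ := Pi.single m 1 with hc₀
  set M : ℝ := (κ * N c₀) ^ (1 / e)
  have hM0 : 0 ≤ M := Real.rpow_nonneg (mul_nonneg hκ0 (hN0 _)) _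
  set K : Set (Fin (n + 1) → ℂ) := Metric.closedBall 0 M ∩ {c | c m = 1} with hK
  have hKc : IsCompact K := (isCompact_closedBall 0 M).inter_right
    (isClosed_eq (continuous_apply m) continuous_const)
  have hmem : ∀ c, c m = 1 → N c ≤ N c₀ → c ∈ K := by
    intro c hcm hc
    refine ⟨?_, hcm⟩
    rw [mem_closedBall_zero_iff, pi_norm_le_iff_of_nonneg hM0]
    intro k
    have h := Real.rpow_le_rpow (by positivity)
      ((hκ c k).trans (mul_le_mul_of_nonneg_left hc hκ0)) (one_div_pos.2 he0).le
    rwa [← Real.rpow_mul (norm_nonneg _), mul_one_div_cancel he0.ne', Real.rpow_one] at h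
  have hc₀m : c₀ m = 1 := by simp [hc₀]
  obtain ⟨c, hcK, hmin⟩ := hKc.exists_isMinOn ⟨c₀, hmem c₀ hc₀m le_rfl⟩
    (continuous_integral_rpow_norm_coeffPoly hμ he).continuousOn
  refine ⟨c, hcK.2, fun c' hc' => ?_⟩
  rcases le_total (N c') (N c₀) with h | h
  · exact hmin (hmem c' hc' h)
  · exact (hmin (hmem c₀ hc₀m le_rfl)).trans h

/-- A polynomial of minimal `L_e` norm with one prescribed coefficient, together with the
orthogonality relations for its dual power. -/
theorem exists_coeffPoly_orthogonal [NullSingletonClass μ] (hμ : ∀ᵐ t ∂μ, t ∈ Icc 0 r) (he : 1 ≤ e) {κ : ℝ}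
    (hκ : ∀ (c : Fin (n + 1) → ℂ) (k : Fin (n + 1)),
      ‖c k‖ ^ e ≤ κ * ∫ t, ‖(coeffPoly c).eval (t : ℂ)‖ ^ e ∂μ) (hκ0 : 0 ≤ κ)
    (m : Fin (n + 1)) :
    ∃ c : Fin (n + 1) → ℂ, c m = 1 ∧ ∀ k : Fin (n + 1),
      ∫ t, dualPower e ((coeffPoly c).eval (t : ℂ)) * (t : ℂ) ^ (k : ℕ) ∂μ =
        if k = m then ((∫ t, ‖(coeffPoly c).eval (t : ℂ)‖ ^ e ∂μ : ℝ) : ℂ) else 0 := by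
  have he0 : 0 < e := by linarith
  obtain ⟨c, hcm, hmin⟩ := exists_minimizer_coeffPoly hμ he hκ hκ0 m
  have hpow : ∀ k : ℕ, Continuous fun t : ℝ => (t : ℂ) ^ k := fun k =>
    Complex.continuous_ofReal.pow k
  have horth : ∀ k : Fin (n + 1), k ≠ m →
      ∫ t, dualPower e ((coeffPoly c).eval (t : ℂ)) * (t : ℂ) ^ (k : ℕ) ∂μ = 0 := by
    intro k hkm
    set J := ∫ t, dualPower e ((coeffPoly c).eval (t : ℂ)) * (t : ℂ) ^ (k : ℕ) ∂μ with hJ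
    -- The descent direction: Re(ωJ) = -|J|², so showing Re(ωJ) ≥ 0 forces J = 0.
    set ω : ℂ := -starRingEnd ℂ J with hω
    set cs : ℝ → Fin (n + 1) → ℂ := fun s => c + Pi.single k (s * ω) with hcs
    have heval : ∀ (s : ℝ) (z : ℂ),
        (coeffPoly (cs s)).eval z = (coeffPoly c).eval z + s * ω * z ^ (k : ℕ) := by
      intro s z
      simp only [eval_coeffPoly, hcs, Pi.add_apply, add_mul, Finset.sum_add_distrib]
      congr 1
      rw [Finset.sum_eq_single k]
      · simp
      · intro b _ hb
        simp [hb]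
      · simp
    -- The subgradient is taken at the perturbed polynomial: minimality then gives the sign for each
    -- s > 0, and only continuity of the dual power is needed as s → 0, not differentiability of the
    -- functional.
    have hnonneg : ∀ s : ℝ, 0 < s →
        0 ≤ (ω * ∫ t, dualPower e ((coeffPoly (cs s)).eval (t : ℂ)) * (t : ℂ) ^ (k : ℕ) ∂μ).re := by
      intro s hs
      have hle := hmin (cs s) (by simp [hcs, hcm, hkm.symm])
      have hint := (integrable_dualPower_mul hμ he (coeffPoly (cs s)) (hpow k)).const_mul (s * ω)
      have hre : Integrable (fun t : ℝ => (s * ω * (dualPower e ((coeffPoly (cs s)).eval (t : ℂ)) *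
          (t : ℂ) ^ (k : ℕ))).re) μ := hint.re
      have hI : ∫ t, (‖(coeffPoly (cs s)).eval (t : ℂ)‖ ^ e - ‖(coeffPoly c).eval (t : ℂ)‖ ^ e) ∂μ ≤
          ∫ t, e * (s * ω * (dualPower e ((coeffPoly (cs s)).eval (t : ℂ)) *
            (t : ℂ) ^ (k : ℕ))).re ∂μ := by
        refine integral_mono ((integrable_rpow_norm_eval hμ he _).sub
          (integrable_rpow_norm_eval hμ he _)) (hre.const_mul e) fun t => ?_
        have h := rpow_norm_sub_le he ((coeffPoly c).eval (t : ℂ)) ((coeffPoly (cs s)).eval (t : ℂ))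
        refine h.trans_eq ?_
        congr 2
        conv_lhs => rw [heval s t, add_sub_cancel_left, ← heval s t]
        ring
      rw [integral_sub (integrable_rpow_norm_eval hμ he _) (integrable_rpow_norm_eval hμ he _),
        integral_const_mul] at hI
      have hre' : ∫ t, (s * ω * (dualPower e ((coeffPoly (cs s)).eval (t : ℂ)) *
          (t : ℂ) ^ (k : ℕ))).re ∂μ =
          (∫ t, s * ω * (dualPower e ((coeffPoly (cs s)).eval (t : ℂ)) *
          (t : ℂ) ^ (k : ℕ)) ∂μ).re := integral_re hint
      rw [hre', integral_const_mul, mul_assoc, Complex.re_ofReal_mul, ← mul_assoc] at hI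
      exact nonneg_of_mul_nonneg_right ((sub_nonneg.2 hle).trans hI) (mul_pos he0 hs)
    have hne : ∀ᵐ t : ℝ ∂μ, (coeffPoly c).eval (t : ℂ) ≠ 0 := by
      refine ae_eval_ne_zero fun h => ?_
      have := coeff_coeffPoly c m
      rw [h, hcm] at this
      simp at this
    have hP : Continuous fun t : ℝ => (coeffPoly c).eval (t : ℂ) :=
      (coeffPoly c).continuous.comp Complex.continuous_ofReal
    have hlim : Filter.Tendsto
        (fun s : ℝ => ∫ t, dualPower e ((coeffPoly (cs s)).eval (t : ℂ)) * (t : ℂ) ^ (k : ℕ) ∂μ)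
        (nhdsWithin 0 (Ioi 0)) (nhds J) := by
      refine tendsto_integral_filter_of_dominated_convergence
        (fun t : ℝ => (‖(coeffPoly c).eval (t : ℂ)‖ + ‖ω‖ * ‖(t : ℂ) ^ (k : ℕ)‖) ^ (e - 1) *
          ‖(t : ℂ) ^ (k : ℕ)‖) ?_ ?_ ?_ ?_
      · exact Filter.Eventually.of_forall fun s =>
          (integrable_dualPower_mul hμ he (coeffPoly (cs s)) (hpow k)).1
      · have h1 : Ioc (0 : ℝ) 1 ∈ nhdsWithin 0 (Ioi 0) := Ioc_mem_nhdsGT zero_lt_one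
        filter_upwards [h1] with s hs
        refine Filter.Eventually.of_forall fun t => ?_
        rw [norm_mul]
        refine mul_le_mul_of_nonneg_right ((norm_dualPower_le _ _).trans ?_) (norm_nonneg _)
        refine Real.rpow_le_rpow (norm_nonneg _) ?_ (by linarith)
        rw [heval]
        refine (norm_add_le _ _).trans ?_
        gcongr
        rw [norm_mul, norm_mul, Complex.norm_of_nonneg hs.1.le]
        refine mul_le_mul_of_nonneg_right ?_ (norm_nonneg _)
        exact mul_le_of_le_one_left (norm_nonneg _) hs.2
      · refine integrable_of_continuous_of_ae_mem hμ (Continuous.mul ?_ (hpow k).norm)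
        exact (hP.norm.add (continuous_const.mul (hpow k).norm)).rpow_const
          fun _ => Or.inr (by linarith)
      · filter_upwards [hne] with t ht
        refine Filter.Tendsto.mul_const _ ?_
        have h0 : Filter.Tendsto (fun s : ℝ => (coeffPoly (cs s)).eval (t : ℂ))
            (nhdsWithin 0 (Ioi 0)) (nhds ((coeffPoly c).eval (t : ℂ))) := by
          simp only [heval]
          have hc : Continuous fun s : ℝ =>
              (coeffPoly c).eval (t : ℂ) + s * ω * (t : ℂ) ^ (k : ℕ) := by fun_prop
          have := (hc.tendsto 0).mono_left (nhdsWithin_le_nhds (s := Ioi 0))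
          simpa using this
        exact (continuousAt_dualPower e ht).tendsto.comp h0
    have hfinal : 0 ≤ (ω * J).re := by
      refine ge_of_tendsto ((Complex.continuous_re.tendsto _).comp (hlim.const_mul ω)) ?_
      filter_upwards [self_mem_nhdsWithin] with s hs
      exact hnonneg s hs
    have hsq : (ω * J).re = -‖J‖ ^ 2 := by
      rw [hω, neg_mul, mul_comm, Complex.mul_conj, Complex.normSq_eq_norm_sq, Complex.neg_re,
        Complex.ofReal_re]
    rw [hsq] at hfinal
    have : ‖J‖ = 0 := by nlinarith [norm_nonneg J]
    exact norm_eq_zero.1 this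
  refine ⟨c, hcm, fun k => ?_⟩
  split_ifs with hkm
  · subst hkm
    -- Expand |P|^e = φ(P) P in the coefficients of P; orthogonality leaves the term with
    -- coefficient 1.
    have h1 : ∫ t, ((‖(coeffPoly c).eval (t : ℂ)‖ ^ e : ℝ) : ℂ) ∂μ =
        ∑ j : Fin (n + 1), c j *
          ∫ t, dualPower e ((coeffPoly c).eval (t : ℂ)) * (t : ℂ) ^ (j : ℕ) ∂μ := by
      simp only [← integral_const_mul]
      rw [← integral_finsetSum _ fun (j : Fin (n + 1)) _ =>
        (integrable_dualPower_mul hμ he (coeffPoly c) (hpow j)).const_mul (c j)]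
      refine integral_congr_ae (Filter.Eventually.of_forall fun t => ?_)
      simp only
      rw [← dualPower_mul_self he]
      conv_lhs => rw [eval_coeffPoly c (t : ℂ), Finset.mul_sum, ← eval_coeffPoly c (t : ℂ)]
      exact Finset.sum_congr rfl fun j _ => by ring
    rw [← integral_complex_ofReal]
    refine Eq.trans ?_ h1.symm
    rw [Finset.sum_eq_single k (fun j _ hj => by rw [horth j hj, mul_zero]) (by simp), hcm, one_mul]
  · exact horth k hkm

end Extremal

/-! ### Lower bound: test functions with a single non-vanishing moment. -/

section Lower

variable {p q : ℝ≥0∞} {u v : ℝ → ℝ} {n : ℕ} {r : ℝ}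

theorem dualIntegral_ne_zero {p : ℝ≥0∞} {u : ℝ → ℝ} (hp : 1 < p) (hu : AEMeasurable u halfLine)
    (s : ℝ) {r : ℝ} (hr : 0 < r) : dualIntegral p u s r ≠ 0 := by
  intro h0
  have hm : AEMeasurable (fun x => ENNReal.ofReal x ^ s * ENNReal.ofReal (u x) ^ (-conjExp p))
      (volume.restrict (Ioo 0 r)) := by
    have hu' : AEMeasurable u (volume.restrict (Ioo 0 r)) :=
      hu.mono_measure (Measure.restrict_mono Ioo_subset_Ioi_self le_rfl)
    fun_prop
  rw [dualIntegral, lintegral_eq_zero_iff' hm] at h0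
  have hF : ∀ᵐ x ∂(volume.restrict (Ioo 0 r)), False := by
    filter_upwards [h0, ae_restrict_mem measurableSet_Ioo] with x hx hxI
    rcases mul_eq_zero.1 hx with h | h
    · rcases ENNReal.rpow_eq_zero_iff.1 h with ⟨h, -⟩ | ⟨h, -⟩
      · exact absurd (ENNReal.ofReal_eq_zero.1 h) (not_le.2 hxI.1)
      · exact ENNReal.ofReal_ne_top h
    · rcases ENNReal.rpow_eq_zero_iff.1 h with ⟨-, h⟩ | ⟨h, -⟩
      · linarith [conjExp_pos hp]
      · exact ENNReal.ofReal_ne_top h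
  rw [Filter.eventually_false_iff_eq_bot, ae_eq_bot, Measure.restrict_eq_zero, Real.volume_Ioo,
    ENNReal.ofReal_eq_zero] at hF
  linarith

/-- Existence of a test polynomial whose dual power has a single non-vanishing moment against the
dual weight. -/
theorem exists_testPoly (hp : 1 < p) (hu : AEMeasurable u halfLine)
    (hd : ∀ r : ℝ, 0 < r → dualIntegral p u 0 r < ∞) {D : ℝ≥0∞} (hD : 1 ≤ D) (hDt : D ≠ ∞)
    (hdoub : ∀ r : ℝ, 0 < r → dualIntegral p u (((n : ℝ) - 1) * conjExp p) (2 * r) ≤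
      D * dualIntegral p u (((n : ℝ) - 1) * conjExp p) r)
    (hr : 0 < r) (m : Fin (n + 1)) :
    ∃ (P : Polynomial ℂ) (I : ℝ), 0 < I ∧
      ∫⁻ t in Ioo 0 r, ‖P.eval (t : ℂ)‖ₑ ^ conjExp p * ENNReal.ofReal (u t) ^ (-conjExp p) =
        ENNReal.ofReal I ∧
      dualIntegral p u ((m : ℕ) * conjExp p) r ≤
        coeffConst (conjExp p) n D * ENNReal.ofReal I ∧
      ∀ k : Fin (n + 1), ∫ t in Ioo 0 r, (t : ℂ) ^ (k : ℕ) *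
        (((ENNReal.ofReal (u t) ^ (-conjExp p)).toReal : ℂ) *
          dualPower (conjExp p) (P.eval (t : ℂ))) = if k = m then (I : ℂ) else 0 := by
  set e := conjExp p
  have he : 1 ≤ e := one_le_conjExp hp
  have he0 : 0 < e := conjExp_pos hp
  set w : ℝ → ℝ≥0∞ := fun t => ENNReal.ofReal (u t) ^ (-e)
  have hle : volume.restrict (Ioo 0 r) ≤ halfLine :=
    Measure.restrict_mono Ioo_subset_Ioi_self le_rfl
  have hwm : AEMeasurable w (volume.restrict (Ioo 0 r)) :=
    (aemeasurable_dualWeight hu e).mono_measure hle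
  have hwfin : ∫⁻ t in Ioo 0 r, w t ≠ ∞ := by
    have h := hd r hr
    simp only [dualIntegral, ENNReal.rpow_zero, one_mul] at h
    exact h.ne
  have hwtop : ∀ᵐ t ∂(volume.restrict (Ioo 0 r)), w t < ∞ := ae_lt_top' hwm hwfin
  set μ : Measure ℝ := (volume.restrict (Ioo 0 r)).withDensity w
  have hac : μ ≪ volume.restrict (Ioo 0 r) := withDensity_absolutelyContinuous _ _
  have : IsFiniteMeasure μ := isFiniteMeasure_withDensity hwfin
  have : NullSingletonClass μ := ⟨fun x => hac (measure_singleton x)⟩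
  have hμ : ∀ᵐ t ∂μ, t ∈ Icc 0 r := by
    refine hac.ae_le ?_
    filter_upwards [ae_restrict_mem measurableSet_Ioo] with t ht using Ioo_subset_Icc_self ht
  have hN : ∀ P : Polynomial ℂ, ∫⁻ t in Ioo 0 r, ‖P.eval (t : ℂ)‖ₑ ^ e * w t =
      ENNReal.ofReal (∫ t, ‖P.eval (t : ℂ)‖ ^ e ∂μ) := by
    intro P
    have hP : Continuous fun t : ℝ => P.eval (t : ℂ) :=
      P.continuous.comp Complex.continuous_ofReal
    rw [ofReal_integral_eq_lintegral_ofReal (integrable_rpow_norm_eval hμ he P)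
      (Filter.Eventually.of_forall fun t => by positivity),
      lintegral_withDensity_eq_lintegral_mul₀ hwm]
    · refine lintegral_congr fun t => ?_
      rw [Pi.mul_apply, mul_comm, ← ENNReal.ofReal_rpow_of_nonneg (norm_nonneg _) he0.le,
        ofReal_norm]
    · exact ((hP.norm.rpow_const fun _ => Or.inr he0.le).measurable.ennreal_ofReal).aemeasurable
  have hcoeff : ∀ (c : Fin (n + 1) → ℂ) (k : Fin (n + 1)),
      ‖c k‖ₑ ^ e * dualIntegral p u ((k : ℕ) * e) r ≤
        coeffConst e n D * ENNReal.ofReal (∫ t, ‖(coeffPoly c).eval (t : ℂ)‖ ^ e ∂μ) := by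
    intro c k
    have h := lintegral_coeff_le he0 hD hdoub (natDegree_coeffPoly_le c) k r
    rwa [hN, coeff_coeffPoly] at h
  have hCt := coeffConst_lt_top he0.le n hDt
  -- This depends on u and r but serves only the existence of a minimiser. The final constant comes
  -- from `hcoeff` at the index m.
  set κ : ℝ≥0∞ := ∑ k : Fin (n + 1), coeffConst e n D / dualIntegral p u ((k : ℕ) * e) r
  have hκt : κ ≠ ∞ := ENNReal.sum_ne_top.2 fun k _ =>
    (ENNReal.div_lt_top hCt.ne (dualIntegral_ne_zero hp hu _ hr)).ne
  have hκ : ∀ (c : Fin (n + 1) → ℂ) (k : Fin (n + 1)),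
      ‖c k‖ ^ e ≤ κ.toReal * ∫ t, ‖(coeffPoly c).eval (t : ℂ)‖ ^ e ∂μ := by
    intro c k
    have hI0 : 0 ≤ ∫ t, ‖(coeffPoly c).eval (t : ℂ)‖ ^ e ∂μ :=
      integral_nonneg fun t => by positivity
    rw [← ENNReal.ofReal_le_ofReal_iff (by positivity), ENNReal.ofReal_mul ENNReal.toReal_nonneg,
      ENNReal.ofReal_toReal hκt, ← ENNReal.ofReal_rpow_of_nonneg (norm_nonneg _) he0.le,
      ofReal_norm]
    have h1 : coeffConst e n D / dualIntegral p u ((k : ℕ) * e) r ≤ κ :=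
      Finset.single_le_sum (f := fun k : Fin (n + 1) =>
        coeffConst e n D / dualIntegral p u ((k : ℕ) * e) r) (fun _ _ => bot_le)
        (Finset.mem_univ k)
    have h2 := (ENNReal.le_div_iff_mul_le (Or.inl (dualIntegral_ne_zero hp hu _ hr))
      (Or.inl (dualIntegral_lt_top hp k (hd r hr)).ne)).2 (hcoeff c k)
    refine h2.trans ?_
    rw [ENNReal.mul_div_right_comm]
    gcongr
  obtain ⟨c, hcm, horth⟩ := exists_coeffPoly_orthogonal hμ he hκ ENNReal.toReal_nonneg m
  refine ⟨coeffPoly c, ∫ t, ‖(coeffPoly c).eval (t : ℂ)‖ ^ e ∂μ, ?_, hN _, ?_, fun k => ?_⟩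
  · have h := hκ c m
    rw [hcm, norm_one, Real.one_rpow] at h
    by_contra hneg
    have := mul_nonpos_of_nonneg_of_nonpos (ENNReal.toReal_nonneg (a := κ)) (not_lt.1 hneg)
    linarith
  · have h := hcoeff c m
    rwa [hcm, enorm_one, ENNReal.one_rpow, one_mul] at h
  · rw [← horth k, integral_withDensity_eq_integral_toReal_smul₀ hwm hwtop]
    refine integral_congr_ae (Filter.Eventually.of_forall fun t => ?_)
    simp only [Complex.real_smul]
    ring

/-- For finite p, (e - 1)p = e turns |u · u^{-e} φ(g)|^p into at most |g|^e u^{-e}. For p = ∞ one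
has e = 1 and 1 / `p.toReal` = 0, so the right side is 1, which bounds |φ|. -/
theorem weightedNorm_testFunction_le (hp : 1 < p) (hu : AEMeasurable u halfLine)
    (hd : ∀ r : ℝ, 0 < r → dualIntegral p u 0 r < ∞) (r : ℝ) (g : ℝ → ℂ) :
    weightedNorm p u ((Ioo 0 r).indicator fun t =>
        ((ENNReal.ofReal (u t) ^ (-conjExp p)).toReal : ℂ) * dualPower (conjExp p) (g t)) ≤
      (∫⁻ t in Ioo 0 r, ‖g t‖ₑ ^ conjExp p * ENNReal.ofReal (u t) ^ (-conjExp p)) ^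
        (1 / p.toReal) := by
  set e := conjExp p with he
  have he1 : 1 ≤ e := one_le_conjExp hp
  have he0 : 0 < e := conjExp_pos hp
  have hpos := ae_pos_of_dualIntegral_lt_top hp hu hd
  have hbound : ∀ t, 0 < u t →
      ‖(u t : ℂ) * (((ENNReal.ofReal (u t) ^ (-e)).toReal : ℂ) * dualPower e (g t))‖ₑ ≤
        ENNReal.ofReal (u t) ^ (1 - e) * ‖g t‖ₑ ^ (e - 1) := by
    intro t ht
    have h0 : ENNReal.ofReal (u t) ≠ 0 := (ENNReal.ofReal_pos.2 ht).ne'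
    have hd1 : ‖dualPower e (g t)‖ₑ ≤ ‖g t‖ₑ ^ (e - 1) := by
      rw [← ofReal_norm, ← ofReal_norm, ENNReal.ofReal_rpow_of_nonneg (norm_nonneg _)
        (by linarith)]
      exact ENNReal.ofReal_le_ofReal (norm_dualPower_le e (g t))
    have hfin : ENNReal.ofReal (u t) ^ (-e) ≠ ∞ := by
      rw [ENNReal.rpow_neg]
      exact ENNReal.inv_ne_top.2 (ENNReal.rpow_pos (ENNReal.ofReal_pos.2 ht)
        ENNReal.ofReal_ne_top).ne'
    rw [enorm_mul, enorm_mul, ← mul_assoc, ← ofReal_norm, ← ofReal_norm,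
      Complex.norm_of_nonneg ht.le, Complex.norm_of_nonneg ENNReal.toReal_nonneg,
      ENNReal.ofReal_toReal hfin]
    rw [show (1 : ℝ) - e = 1 + -e by ring, ENNReal.rpow_add _ _ h0 ENNReal.ofReal_ne_top,
      ENNReal.rpow_one]
    gcongr
  by_cases hpt : p = ∞
  · subst hpt
    have he' : e = 1 := conjExp_top
    rw [weightedNorm, eLpNorm_exponent_top]
    refine eLpNormEssSup_le_of_ae_enorm_bound ?_
    filter_upwards [hpos] with t ht
    by_cases htI : t ∈ Ioo 0 r
    · rw [indicator_of_mem htI]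
      refine (hbound t ht).trans ?_
      simp [he']
    · rw [indicator_of_notMem htI]
      simp
  · have hconj := holderConjugate_conjExp hp hpt
    have hp0 : p ≠ 0 := (zero_lt_one.trans hp).ne'
    have hpr : 0 < p.toReal := ENNReal.toReal_pos hp0 hpt
    rw [weightedNorm, eLpNorm_eq_lintegral_rpow_enorm_toReal hp0 hpt]
    refine ENNReal.rpow_le_rpow ?_ (by positivity)
    rw [← lintegral_indicator measurableSet_Ioo]
    refine (lintegral_mono_ae ?_).trans (lintegral_mono' Measure.restrict_le_self le_rfl)
    filter_upwards [hpos] with t ht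
    have hmul : (e - 1) * p.toReal = e := by
      have := hconj.symm.sub_one_mul_conj
      exact this
    by_cases htI : t ∈ Ioo 0 r
    · rw [indicator_of_mem htI, indicator_of_mem htI]
      refine (ENNReal.rpow_le_rpow (hbound t ht) hpr.le).trans_eq ?_
      rw [ENNReal.mul_rpow_of_nonneg _ _ hpr.le, ← ENNReal.rpow_mul, ← ENNReal.rpow_mul, hmul,
        show (1 - e) * p.toReal = -e by linarith, mul_comm]
    · rw [indicator_of_notMem htI, indicator_of_notMem htI]
      simp [hpr]

theorem one_div_toReal_add_one_div_conjExp (hp : 1 < p) :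
    1 / p.toReal + 1 / conjExp p = 1 := by
  by_cases hpt : p = ∞
  · subst hpt
    simp [conjExp_top]
  · have := (holderConjugate_conjExp hp hpt).inv_add_inv_eq_one
    simpa [one_div] using this

/-- Boundedness of the sum bounds each of the constants `S_k`. -/
theorem hardyConst_le_of_boundedWith (hp : 1 < p) (hu : AEMeasurable u halfLine)
    (hd : ∀ r : ℝ, 0 < r → dualIntegral p u 0 r < ∞) {D : ℝ≥0∞} (hD : 1 ≤ D) (hDt : D ≠ ∞)
    (hdoub : ∀ r : ℝ, 0 < r → dualIntegral p u (((n : ℝ) - 1) * conjExp p) (2 * r) ≤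
      D * dualIntegral p u (((n : ℝ) - 1) * conjExp p) r)
    {a : Fin (n + 1) → ℝ → ℂ} {c : ℝ≥0} (hc : BoundedWith p q u v (sumOp a) c)
    (m : Fin (n + 1)) :
    hardyConst p q u v (a m) m ≤ coeffConst (conjExp p) n D ^ (1 / conjExp p) * c := by
  refine iSup₂_le fun r hr => ?_
  obtain ⟨P, I, hI0, hPI, hmI, hmom⟩ := exists_testPoly hp hu hd hD hDt hdoub hr m
  set e := conjExp p
  have he0 : 0 < e := conjExp_pos hp
  set g : ℝ → ℂ := fun t => ((ENNReal.ofReal (u t) ^ (-e)).toReal : ℂ) *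
    dualPower e (P.eval (t : ℂ)) with hg
  set f : ℝ → ℂ := (Ioo 0 r).indicator g with hf
  have hP : Continuous fun t : ℝ => P.eval (t : ℂ) := P.continuous.comp Complex.continuous_ofReal
  have hfm : AEStronglyMeasurable f halfLine := by
    refine AEStronglyMeasurable.indicator ?_ measurableSet_Ioo
    refine AEMeasurable.aestronglyMeasurable ?_
    exact (Complex.measurable_ofReal.comp_aemeasurable
      (aemeasurable_dualWeight hu e).ennreal_toReal).mul
      ((measurable_dualPower e).comp hP.measurable).aemeasurable
  have hfn : weightedNorm p u f ≤ ENNReal.ofReal I ^ (1 / p.toReal) := by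
    rw [← hPI]
    exact weightedNorm_testFunction_le hp hu hd r fun t => P.eval (t : ℂ)
  have hpr : 0 ≤ 1 / p.toReal := by positivity
  have hbd := (hc f hfm (hfn.trans_lt (ENNReal.rpow_lt_top_of_nonneg hpr (by simp)))).trans
    (mul_le_mul_right hfn _)
  have hsum : ∀ x ∈ Ioi r, sumOp a f x = a m x * I := by
    intro x hx
    have hmomf : ∀ k : Fin (n + 1), moment k f x = if k = m then (I : ℂ) else 0 := by
      intro k
      rw [← hmom k, moment]
      have h1 : (fun t : ℝ => (t : ℂ) ^ (k : ℕ) * f t) =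
          (Ioo 0 r).indicator fun t => (t : ℂ) ^ (k : ℕ) * g t := by
        funext t
        by_cases ht : t ∈ Ioo 0 r
        · simp [hf, ht]
        · simp [hf, ht]
      rw [h1, setIntegral_indicator measurableSet_Ioo, inter_eq_self_of_subset_right]
      exact Ioo_subset_Ioo_right (le_of_lt hx)
    rw [sumOp, Finset.sum_eq_single m]
    · rw [summandOp, hmomf, if_pos rfl]
    · intro k _ hk
      rw [summandOp, hmomf, if_neg hk, mul_zero]
    · simp
  set A := eLpNorm (fun x => a m x * (v x : ℂ)) q (volume.restrict (Ioi r))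
  have hA : ENNReal.ofReal I * A ≤ c * ENNReal.ofReal I ^ (1 / p.toReal) := by
    refine le_trans (le_of_eq ?_) ((eLpNorm_mono_measure _
      (Measure.restrict_mono (Ioi_subset_Ioi hr.le) le_rfl)).trans hbd)
    have h1 : eLpNorm (fun x => (v x : ℂ) * sumOp a f x) q (volume.restrict (Ioi r)) =
        eLpNorm ((I : ℂ) • fun x => a m x * (v x : ℂ)) q (volume.restrict (Ioi r)) := by
      refine eLpNorm_congr_ae ?_
      filter_upwards [ae_restrict_mem measurableSet_Ioi] with x hx
      rw [hsum x hx, Pi.smul_apply, smul_eq_mul]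
      ring
    rw [h1, eLpNorm_const_smul, ← ofReal_norm, Complex.norm_of_nonneg hI0.le]
  have hI : ENNReal.ofReal I ≠ 0 := (ENNReal.ofReal_pos.2 hI0).ne'
  -- Cancel I^{1/p}, which is positive and finite, and use 1 - 1/p = 1/p'.
  have hIe : A * ENNReal.ofReal I ^ (1 / e) ≤ c := by
    have hIp0 : ENNReal.ofReal I ^ (1 / p.toReal) ≠ 0 :=
      (ENNReal.rpow_pos (ENNReal.ofReal_pos.2 hI0) (by simp)).ne'
    have hIpt : ENNReal.ofReal I ^ (1 / p.toReal) ≠ ∞ :=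
      (ENNReal.rpow_lt_top_of_nonneg hpr (by simp)).ne
    rw [← ENNReal.mul_le_mul_iff_left hIp0 hIpt]
    refine le_trans (le_of_eq ?_) hA
    rw [mul_assoc, ← ENNReal.rpow_add _ _ hI (by simp), add_comm,
      one_div_toReal_add_one_div_conjExp hp, ENNReal.rpow_one, mul_comm]
  calc A * dualIntegral p u ((m : ℕ) * e) r ^ (1 / e)
      ≤ A * (coeffConst e n D * ENNReal.ofReal I) ^ (1 / e) := by gcongr
    _ = coeffConst e n D ^ (1 / e) * (A * ENNReal.ofReal I ^ (1 / e)) := by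
        rw [ENNReal.mul_rpow_of_nonneg _ _ (by positivity)]
        ring
    _ ≤ _ := by gcongr

end Lower

/-! ### Assembly of the equivalences and of the two-sided estimate. -/

section Main

variable {p q : ℝ≥0∞} {u v : ℝ → ℝ} {n : ℕ} {a : Fin (n + 1) → ℝ → ℂ}

theorem boundedWith_sumOp (hq : 1 ≤ q) (ha : ∀ k, AEMeasurable (a k) halfLine)
    (hv : AEMeasurable v halfLine) {c : Fin (n + 1) → ℝ≥0}
    (hc : ∀ k : Fin (n + 1), BoundedWith p q u v (summandOp (a k) k) (c k)) :
    BoundedWith p q u v (sumOp a) (∑ k, c k) := by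
  intro f hf hfu
  have hm : ∀ k ∈ Finset.univ, AEStronglyMeasurable
      (fun x => (v x : ℂ) * summandOp (a k) (k : ℕ) f x) halfLine := fun k _ =>
    (Complex.measurable_ofReal.comp_aemeasurable hv).aestronglyMeasurable.mul
      ((ha k).aestronglyMeasurable.mul (aestronglyMeasurable_moment hf k))
  have h1 : (fun x => (v x : ℂ) * sumOp a f x) =
      ∑ k : Fin (n + 1), fun x => (v x : ℂ) * summandOp (a k) (k : ℕ) f x := by
    funext x
    simp [sumOp, Finset.mul_sum]
  rw [weightedNorm, h1]
  refine (eLpNorm_sum_le hm hq).trans ?_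
  push_cast
  rw [Finset.sum_mul]
  exact Finset.sum_le_sum fun k _ => hc k f hf hfu

theorem boundedWith_summandOp (hp : 1 < p) (hpq : p ≤ q) (hu : AEMeasurable u halfLine)
    (hd : ∀ r : ℝ, 0 < r → dualIntegral p u 0 r < ∞) {b : ℝ → ℂ} {k : ℕ}
    (hS : hardyConst p q u v b k < ∞) :
    BoundedWith p q u v (summandOp b k) (4 * (hardyConst p q u v b k).toNNReal) := by
  intro f hf hfu
  refine (weightedNorm_summandOp_le hp hpq hu hd hf hfu).trans_eq ?_
  push_cast
  rw [ENNReal.coe_toNNReal hS.ne]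

end Main

end WeightedHardy

theorem theorem2p1 (p q : ℝ≥0∞) (hp : 1 < p) (hpq : p ≤ q) :
    ∃ K₁ : ℝ≥0, 0 < K₁ ∧ ∀ (n : ℕ) (D : ℝ≥0), ∃ K₂ : ℝ≥0, 0 < K₂ ∧
      ∀ (a : Fin (n + 1) → ℝ → ℂ) (u v : ℝ → ℝ),
        (∀ k, AEMeasurable (a k) WeightedHardy.halfLine) →
        AEMeasurable u WeightedHardy.halfLine →
        AEMeasurable v WeightedHardy.halfLine →
        (∀ x : ℝ, 0 < x → 0 ≤ u x) →
        (∀ x : ℝ, 0 < x → 0 ≤ v x) →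
        (∀ r : ℝ, 0 < r → WeightedHardy.dualIntegral p u 0 r < ∞) →
        (∀ r : ℝ, 0 < r →
          WeightedHardy.dualIntegral p u (((n : ℝ) - 1) * WeightedHardy.conjExp p) (2 * r) ≤
            D * WeightedHardy.dualIntegral p u (((n : ℝ) - 1) * WeightedHardy.conjExp p) r) →
        List.TFAE [
          ∃ c : ℝ≥0, WeightedHardy.BoundedWith p q u v (WeightedHardy.sumOp a) c,
          ∀ k : Fin (n + 1), ∃ c : ℝ≥0,
            WeightedHardy.BoundedWith p q u v (WeightedHardy.summandOp (a k) k) c,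
          ∀ k : Fin (n + 1), WeightedHardy.hardyConst p q u v (a k) k < ∞] ∧
        K₁ * WeightedHardy.bestConst p q u v (WeightedHardy.sumOp a) ≤
          ∑ k : Fin (n + 1), WeightedHardy.hardyConst p q u v (a k) k ∧
        ∑ k : Fin (n + 1), WeightedHardy.hardyConst p q u v (a k) k ≤
          K₂ * WeightedHardy.bestConst p q u v (WeightedHardy.sumOp a) := by
  open WeightedHardy in
  -- The reciprocal of the constant in Hardy's inequality.
  refine ⟨4⁻¹, by positivity, fun n D => ?_⟩
  have he0 := conjExp_pos hp
  set C : ℝ≥0∞ := coeffConst (conjExp p) n (max D 1 : ℝ≥0) ^ (1 / conjExp p)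
  have hCt : C ≠ ∞ := (ENNReal.rpow_lt_top_of_nonneg (by positivity)
    (coeffConst_lt_top he0.le n ENNReal.coe_ne_top).ne).ne
  -- Each of the n + 1 constants is at most C times any admissible c. The added 1 makes positivity
  -- immediate.
  refine ⟨(n + 1) * C.toNNReal + 1, by positivity,
    fun a u v ha hu hv _ _ hd hdoub => ?_⟩
  have hdoub' : ∀ r : ℝ, 0 < r → dualIntegral p u (((n : ℝ) - 1) * conjExp p) (2 * r) ≤
      (max D 1 : ℝ≥0) * dualIntegral p u (((n : ℝ) - 1) * conjExp p) r := fun r hr =>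
    (hdoub r hr).trans (by gcongr; exact le_max_left _ _)
  have hlow : ∀ (c : ℝ≥0), BoundedWith p q u v (sumOp a) c → ∀ k : Fin (n + 1),
      hardyConst p q u v (a k) k ≤ C * c := fun c hc k =>
    hardyConst_le_of_boundedWith hp hu hd (by simp) ENNReal.coe_ne_top hdoub' hc k
  have hq : 1 ≤ q := hp.le.trans hpq
  refine ⟨?_, ?_, ?_⟩
  · tfae_have 1 → 3 := fun ⟨c, hc⟩ k =>
      (hlow c hc k).trans_lt (ENNReal.mul_lt_top hCt.lt_top ENNReal.coe_lt_top)
    tfae_have 3 → 2 := fun h k => ⟨_, boundedWith_summandOp hp hpq hu hd (h k)⟩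
    tfae_have 2 → 1 := fun h => by
      choose c hc using h
      exact ⟨_, boundedWith_sumOp hq ha hv hc⟩
    tfae_finish
  · by_cases hS : ∀ k : Fin (n + 1), hardyConst p q u v (a k) k < ∞
    · have h := boundedWith_sumOp hq ha hv fun k => boundedWith_summandOp hp hpq hu hd (hS k)
      have hb : bestConst p q u v (sumOp a) ≤
          4 * ∑ k : Fin (n + 1), hardyConst p q u v (a k) k := by
        refine (iInf₂_le _ h).trans_eq ?_
        push_cast
        rw [Finset.mul_sum]
        exact Finset.sum_congr rfl fun k _ => by rw [ENNReal.coe_toNNReal (hS k).ne]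
      rw [ENNReal.coe_inv (by norm_num), mul_comm, ← div_eq_mul_inv]
      refine ENNReal.div_le_of_le_mul' ?_
      exact_mod_cast hb
    · push Not at hS
      obtain ⟨k, hk⟩ := hS
      rw [ENNReal.sum_eq_top.2 ⟨k, Finset.mem_univ k, top_le_iff.1 hk⟩]
      exact le_top
  · have hK0 : (((n + 1) * C.toNNReal + 1 : ℝ≥0) : ℝ≥0∞) ≠ 0 := by
      exact_mod_cast (by positivity : (0 : ℝ≥0) < (n + 1) * C.toNNReal + 1).ne'
    rw [bestConst, ENNReal.mul_iInf_of_ne hK0 ENNReal.coe_ne_top]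
    refine le_iInf fun c => ?_
    rw [ENNReal.mul_iInf_of_ne hK0 ENNReal.coe_ne_top]
    refine le_iInf fun hc => ?_
    calc ∑ k : Fin (n + 1), hardyConst p q u v (a k) k
        ≤ ∑ _k : Fin (n + 1), C * c := Finset.sum_le_sum fun k _ => hlow c hc k
      _ = (n + 1) * C * c := by
          rw [Finset.sum_const, Finset.card_univ, Fintype.card_fin, nsmul_eq_mul]
          push_cast
          ring
      _ ≤ _ := by
          push_cast
          rw [ENNReal.coe_toNNReal hCt]
          gcongr
          exact le_self_add
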